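/- Let $n\ge 7$. Consider orderings $\alpha=(\alpha_1,\dots,\alpha_n)$ of the labels $\{1,\dots,n\}$ up to cyclic rotation and reflection. For two orderings $\alpha,\beta$ let $I(\alpha,\beta)$ be the number of unrooted binary trees with $n$ leaves labelled $1,\dots,n$ (up to isomorphisms fixing the labels) that admit both a planar embedding with leaves in the cyclic order $\alpha$ and one with leaves in the cyclic order $\beta$. The $\frac{(n-1)!}{2}\times\frac{(n-1)!}{2}$ matrix $(I(\alpha,\beta))$ is the intersection matrix for $n$, and the density of a matrix is the number of its nonzero entries divided by the number of all its entries. These definitions are used for every number of leaves $\ge 3$. Put $m=\lceil (n-3)/2\rceil+1$, $\bar m=\lfloor (n-3)/2\rfloor+1$ and $d=\lceil (n-3)/2\rceil!\,\lfloor (n-3)/2\rfloor!=(m-1)!\,(\bar m-1)!$. For a subset $H\subseteq\{2,\dots,n-2\}$ with $|H|=\lceil (n-3)/2\rceil$ and complement $G=\{2,\dots,n-2\}\setminus H$, the KLT block of $H$ is the submatrix of the intersection matrix with rows indexed by the orderings $(1,h,g,n-1,n)$ and columns indexed by the orderings $(1,h',n,g',n-1)$, where $h,h'$ run over all arrangements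 of $H$ and $g,g'$ over all arrangements of $G$. Let $S_1=S_2=1$, $S_3=3$, $S_4=11$, $S_5=45,\dots$ be the super-Catalan (Schröder–Hipparchus, little Schröder) numbers. Then for every $n\ge 7$ and every such $H$: 1. the KLT block of $H$ has size $d\times d$, and each of its rows has exactly $4\,S_{m-1}S_{\bar m-1}$ nonzero entries; 2. hence the density of the block is $$\frac{4\,S_{m-1}S_{\bar m-1}}{(m-1)!\,(\bar m-1)!},$$ and it equals the product of the densities of the intersection matrices for $m$ and for $\bar m$ leaves; 3. with $c=1+\log 2+\log(3+\sqrt 8)=3.4558\ldots$ (so that $|c-3.46|<0.005$), the density of the block is $e^{-n(\log n-c)+O(\log n)}$ as $n\to\infty$, with the constant in $O(\log n)$ independent of $n$ and $H$. -/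

import Mathlib

/-! ## Orderings -/

/-- The group of rotations and reflections of the `n` positions on a circle. -/
def positionSymmetries (n : ℕ) : Subgroup (Equiv.Perm (Fin n)) :=
  Subgroup.closure {finRotate n, Fin.revPerm}

/-- Orderings `(α₁, …, αₙ)` of `n` labels, up to cyclic rotation and reflection.  A bijection
`α : Equiv.Perm (Fin n)` sends a position to the label standing there. -/
abbrev CircularOrdering (n : ℕ) : Type :=
  Equiv.Perm (Fin n) ⧸ positionSymmetries n

/-- `q` is represented by the word `l` in the labels `1, …, n`
(the element `i : Fin n` stands for the label `i + 1`). -/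
def CircularOrdering.HasWord {n : ℕ} (q : CircularOrdering n) (l : List ℕ) : Prop :=
  ∃ α : Equiv.Perm (Fin n), (QuotientGroup.mk α : CircularOrdering n) = q ∧
    List.ofFn (fun i => (α i : ℕ) + 1) = l

/-! ## Planar embeddings of graphs, given by rotation systems -/

/-- A rotation system: a cyclic order on the darts (oriented edges) leaving each vertex. -/
structure RotationSystem {V : Type} (G : SimpleGraph V) where
  /-- the next dart in the cyclic order around the starting vertex -/
  rot : Equiv.Perm G.Dart
  fst_rot : ∀ d, (rot d).fst = d.fst
  cyclic : ∀ d e : G.Dart, d.fst = e.fst → rot.SameCycle d e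

/-- One step along the boundary of a face: run along the dart `d`, then leave its end by the dart
that follows the reversal of `d` in the cyclic order. -/
def RotationSystem.faceStep {V : Type} {G : SimpleGraph V} (R : RotationSystem G)
    (d : G.Dart) : G.Dart :=
  R.rot d.symm

/-! ## Unrooted binary trees with labelled leaves -/

/-- Unrooted binary trees with leaves labelled by `Fin n`, on a fixed set of `n - 2` internal
vertices: trees in which leaves have degree one and internal vertices have degree three. -/
def LabelledBinaryTree (n : ℕ) : Type :=
  {G : SimpleGraph (Fin n ⊕ Fin (n - 2)) // G.IsTree ∧
    (∀ i : Fin n, (G.neighborSet (Sum.inl i)).ncard = 1) ∧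
    (∀ j : Fin (n - 2), (G.neighborSet (Sum.inr j)).ncard = 3)}

/-- Two trees are identified if they differ by a renaming of the internal vertices, that is,
by a graph isomorphism that fixes all leaf labels. -/
def labelledBinaryTreeSetoid (n : ℕ) : Setoid (LabelledBinaryTree n) where
  r S T := ∃ π : Equiv.Perm (Fin (n - 2)), ∀ u v,
    T.1.Adj (Sum.map id π u) (Sum.map id π v) ↔ S.1.Adj u v
  iseqv :=
    { refl := fun S => ⟨1, fun u v => by
        cases u <;> cases v <;> rfl⟩
      symm := by
        rintro S T ⟨π, h⟩
        refine ⟨π⁻¹, fun u v => ?_⟩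
        rw [← h]
        cases u <;> cases v <;> simp
      trans := by
        rintro S T U ⟨π, h⟩ ⟨ρ, k⟩
        refine ⟨ρ * π, fun u v => ?_⟩
        rw [← h, ← k]
        cases u <;> cases v <;> simp }

/-- Isomorphism classes of unrooted binary trees with `n` labelled leaves. -/
def UnrootedBinaryTree (n : ℕ) : Type :=
  Quotient (labelledBinaryTreeSetoid n)

/-- Walking around the embedded tree, the first leaf met after the leaf `a` is the leaf `b`. -/
def RotationSystem.NextLeaf {n k : ℕ} {G : SimpleGraph (Fin n ⊕ Fin k)} (R : RotationSystem G)
    (a b : Fin n) : Prop :=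
  ∃ (d : G.Dart) (t : ℕ), d.fst = Sum.inl a ∧ 0 < t ∧ (R.faceStep^[t] d).fst = Sum.inl b ∧
    ∀ s, 0 < s → s < t → ∀ c : Fin n, (R.faceStep^[s] d).fst ≠ Sum.inl c

/-- The tree has a planar embedding whose leaves appear around it in the cyclic order `α`. -/
def LabelledBinaryTree.IsPlanarFor {n : ℕ} (T : LabelledBinaryTree n) (α : Equiv.Perm (Fin n)) : Prop :=
  ∃ R : RotationSystem T.1, ∀ i : Fin n, R.NextLeaf (α i) (α (finRotate n i))

/-- The set of unrooted binary trees that are planar with respect to the ordering `q`. -/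
def planarTrees {n : ℕ} (q : CircularOrdering n) : Set (UnrootedBinaryTree n) :=
  {T | ∃ (S : LabelledBinaryTree n) (α : Equiv.Perm (Fin n)),
    Quotient.mk (labelledBinaryTreeSetoid n) S = T ∧ (QuotientGroup.mk α : CircularOrdering n) = q ∧
    S.IsPlanarFor α}

/-! ## The intersection matrix, its KLT blocks, and densities -/

/-- The intersection matrix: the number of unrooted binary trees planar for both orderings. -/
noncomputable def intersectionMatrix (n : ℕ) : Matrix (CircularOrdering n) (CircularOrdering n) ℕ :=
  fun p q => (planarTrees p ∩ planarTrees q).ncard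

/-- The ratio of the number of nonzero entries of a finite matrix to the number of its entries. -/
noncomputable def matrixDensity {R C : Type} (M : Matrix R C ℕ) : ℝ :=
  (Nat.card {x : R × C // M x.1 x.2 ≠ 0} : ℝ) / (Nat.card (R × C) : ℝ)

/-- The orderings `(1, h, g, n-1, n)`, where `h` lists the set `H` and `g` lists the complement of
`H` in `{2, …, n-2}`. -/
def kltRows (n : ℕ) (H : Finset ℕ) : Set (CircularOrdering n) :=
  {q | ∃ h g : List ℕ, (h : Multiset ℕ) = H.val ∧
    (g : Multiset ℕ) = (Finset.Icc 2 (n - 2) \ H).val ∧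
    q.HasWord ([1] ++ h ++ g ++ [n - 1, n])}

/-- The orderings `(1, h, n, g, n-1)`, where `h` lists the set `H` and `g` lists the complement of
`H` in `{2, …, n-2}`. -/
def kltCols (n : ℕ) (H : Finset ℕ) : Set (CircularOrdering n) :=
  {q | ∃ h g : List ℕ, (h : Multiset ℕ) = H.val ∧
    (g : Multiset ℕ) = (Finset.Icc 2 (n - 2) \ H).val ∧
    q.HasWord ([1] ++ h ++ [n] ++ g ++ [n - 1])}

/-- The KLT block that belongs to the set `H`. -/
noncomputable def kltBlock (n : ℕ) (H : Finset ℕ) : Matrix (kltRows n H) (kltCols n H) ℕ :=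
  fun p q => intersectionMatrix n p q

/-- `H` indexes a KLT block: it is a subset of `{2, …, n-2}` of size `⌈(n-3)/2⌉`. -/
def IsKLTIndex (n : ℕ) (H : Finset ℕ) : Prop :=
  H ⊆ Finset.Icc 2 (n - 2) ∧ H.card = ⌈((n : ℚ) - 3) / 2⌉₊

/-! Cut two circular orderings open at a common label `a` and call the remaining words `l` and `l'`.
The matrix entry is nonzero exactly when `l, l'` is a separable pair
(`intersectionMatrix_ne_zero_iff`). Indeed, a tree rooted at the leaf `a` becomes a plane binary
tree once it is embedded, and a vertex of degree three has only two cyclic orders, so two embeddings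
differ by exchanging the branches at some internal vertices (`RotationSystem.exists_unfolds`).
Conversely, the recursion behind a separable pair builds a plane tree and a flipped copy with the
same graph (`PlaneTree.exists_flip`, `LabelledBinaryTree.exists_isPlanarFor`).

Write L for the large Schröder numbers. A word of k + 1 distinct letters has L_k separable partners
(`ncard_separableWords`): cutting at the shortest common initial block reproduces the Schröder
recurrence. A circular ordering is a word starting with 1, up to reversal of the rest. So the matrix
for m leaves has (m-1)!/2 columns and L_{m-2}/2 nonzero entries in each row.

In a KLT block, cut at n-1. The words (n,1,h,g) and (1,h',n,g') are separable if and only if both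
(h,h') and (g,g') are (`separablePair_klt_iff`): restrict to the letters of H or of G for one
direction, and assemble the blocks for the other. No reversal is left to identify, so a row has
L_{|H|-1} L_{|G|-1} nonzero entries among |H|! |G|! columns. These are the data of the full matrices
for |H|+1 and |G|+1 leaves with all factors 1/2 cancelled, and L_{k-1} = 2 S_k for k ≥ 2 gives the
factor 4.

For the asymptotics, the three-term recurrence squeezes L_k between (3+√8)^k times polynomial
factors, and Stirling's bounds are applied to the two factorials, whose arguments are n/2 + O(1). -/

/-- Two words form a separable pair if the second arises from the first by recursively
splitting it into blocks and possibly exchanging them. -/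
inductive SeparablePair {α : Type*} : List α → List α → Prop
  | nil : SeparablePair [] []
  | single (a : α) : SeparablePair [a] [a]
  | plus {u u' v v' : List α} : SeparablePair u u' → SeparablePair v v' →
      SeparablePair (u ++ v) (u' ++ v')
  | minus {u u' v v' : List α} : SeparablePair u u' → SeparablePair v v' →
      SeparablePair (u ++ v) (v' ++ u')

/-! ### Separable pairs: symmetries, restriction, splitting -/

namespace SeparablePair

variable {α β : Type*}

theorem perm {w l : List α} (h : SeparablePair w l) : l.Perm w := by
  induction h with
  | nil => exact .refl _
  | single => exact .refl _
  | plus _ _ ih₁ ih₂ => exact ih₁.append ih₂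
  | minus _ _ ih₁ ih₂ => exact List.perm_append_comm.trans (ih₁.append ih₂)

theorem symm {w l : List α} (h : SeparablePair w l) : SeparablePair l w := by
  induction h with
  | nil => exact .nil
  | single => exact .single _
  | plus _ _ ih₁ ih₂ => exact ih₁.plus ih₂
  | minus _ _ ih₁ ih₂ => exact ih₂.minus ih₁

theorem reverse_right {w l : List α} (h : SeparablePair w l) : SeparablePair w l.reverse := by
  induction h with
  | nil => exact .nil
  | single => exact .single _
  | plus _ _ ih₁ ih₂ => rw [List.reverse_append]; exact ih₁.minus ih₂
  | minus _ _ ih₁ ih₂ => rw [List.reverse_append]; exact ih₁.plus ih₂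

theorem reverse_left {w l : List α} (h : SeparablePair w l) : SeparablePair w.reverse l :=
  h.symm.reverse_right.symm

theorem map {w l : List α} (h : SeparablePair w l) (f : α → β) :
    SeparablePair (w.map f) (l.map f) := by
  induction h with
  | nil => exact .nil
  | single => exact .single _
  | plus _ _ ih₁ ih₂ => rw [List.map_append, List.map_append]; exact ih₁.plus ih₂
  | minus _ _ ih₁ ih₂ => rw [List.map_append, List.map_append]; exact ih₁.minus ih₂

theorem filter {w l : List α} (h : SeparablePair w l) (p : α → Bool) :
    SeparablePair (w.filter p) (l.filter p) := by
  induction h with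
  | nil => exact .nil
  | single a => by_cases h : p a <;> simp [h, single, nil]
  | plus _ _ ih₁ ih₂ => rw [List.filter_append, List.filter_append]; exact ih₁.plus ih₂
  | minus _ _ ih₁ ih₂ => rw [List.filter_append, List.filter_append]; exact ih₁.minus ih₂

theorem length_eq {w l : List α} (h : SeparablePair w l) : l.length = w.length := h.perm.length_eq

/-- This is the outermost step of the recursion. The constructors allow empty blocks; then the other
block is the whole word and its induction hypothesis applies. -/
theorem exists_split {w l : List α} (h : SeparablePair w l) (hw : 2 ≤ w.length) :
    ∃ i, 0 < i ∧ i < w.length ∧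
      ((l.take i).Perm (w.take i) ∨ (l.take i).Perm (w.drop (w.length - i))) := by
  induction h with
  | nil => simp at hw
  | single => simp at hw
  | @plus u u' v v' hu hv ih₁ ih₂ =>
    have h1 := hu.length_eq
    have h2 := hv.length_eq
    rcases List.eq_nil_or_concat u with rfl | ⟨_, _, rfl⟩
    · obtain rfl : u' = [] := by simpa using h1
      simpa using ih₂ (by simpa using hw)
    rcases List.eq_nil_or_concat v with rfl | ⟨_, _, rfl⟩
    · obtain rfl : v' = [] := by simpa using h2
      simpa using ih₁ (by simpa using hw)
    refine ⟨u'.length, by simp [h1], by simp [h1], .inl ?_⟩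
    rw [List.take_left, h1, List.take_left]
    exact hu.perm
  | @minus u u' v v' hu hv ih₁ ih₂ =>
    have h1 := hu.length_eq
    have h2 := hv.length_eq
    rcases List.eq_nil_or_concat u with rfl | ⟨_, _, rfl⟩
    · obtain rfl : u' = [] := by simpa using h1
      simpa using ih₂ (by simpa using hw)
    rcases List.eq_nil_or_concat v with rfl | ⟨_, _, rfl⟩
    · obtain rfl : v' = [] := by simpa using h2
      simpa using ih₁ (by simpa using hw)
    refine ⟨v'.length, by simp [h2], by simp [h2]; omega, .inr ?_⟩
    rw [List.take_left, List.length_append, h2, Nat.add_sub_cancel, List.drop_left]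
    exact hv.perm

theorem filter_mem_append_left [DecidableEq α] {u v x y : List α} (huv : (u ++ v).Nodup)
    (hx : x.Perm u) (hy : y.Perm v) : (x ++ y).filter (fun a => decide (a ∈ u)) = x := by
  have hd := List.disjoint_of_nodup_append huv
  rw [List.filter_append, List.filter_eq_self.2, List.filter_eq_nil_iff.2, List.append_nil]
  · intro a ha
    simpa using fun h => hd h (hy.subset ha)
  · intro a ha
    simpa using hx.subset ha

theorem filter_mem_append_right [DecidableEq α] {u v x y : List α} (huv : (u ++ v).Nodup)
    (hx : x.Perm u) (hy : y.Perm v) : (x ++ y).filter (fun a => decide (a ∈ v)) = y := by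
  have hd := List.disjoint_of_nodup_append huv
  rw [List.filter_append, List.filter_eq_nil_iff.2, List.filter_eq_self.2, List.nil_append]
  · intro a ha
    simpa using hy.subset ha
  · intro a ha
    simpa using fun h => hd (hx.subset ha) h

/-- Separability survives deleting letters. As letters are distinct, keeping those of `u` or those
of `v` isolates the corresponding blocks. -/
theorem split {u v x y : List α} (h : SeparablePair (u ++ v) (x ++ y)) (huv : (u ++ v).Nodup)
    (hx : x.Perm u) (hy : y.Perm v) : SeparablePair u x ∧ SeparablePair v y := by
  classical
  constructor
  · have := h.filter (fun a => decide (a ∈ u))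
    rwa [filter_mem_append_left huv hx hy, filter_mem_append_left huv (.refl _) (.refl _)] at this
  · have := h.filter (fun a => decide (a ∈ v))
    rwa [filter_mem_append_right huv hx hy, filter_mem_append_right huv (.refl _) (.refl _)] at this

end SeparablePair

/-! ### Counting separable partners by Schröder numbers -/

section Counting

variable {α : Type*}

theorem List.finite_setOf_perm (w : List α) : {l : List α | l.Perm w}.Finite := by
  classical
  refine (w.permutations.toFinset.finite_toSet).subset fun l hl => ?_
  simpa using hl

/-- The words that form a separable pair with `w`. -/
def separableWords (w : List α) : Set (List α) := {l | SeparablePair w l}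

/-- The words that form a separable pair with `w` and share a proper initial block with it. -/
def decomposableWords (w : List α) : Set (List α) :=
  {l | SeparablePair w l ∧ ∃ i, 0 < i ∧ i < w.length ∧ (l.take i).Perm (w.take i)}

theorem finite_separableWords (w : List α) : (separableWords w).Finite :=
  (List.finite_setOf_perm w).subset fun _ h => SeparablePair.perm h

theorem decomposableWords_subset (w : List α) : decomposableWords w ⊆ separableWords w :=
  fun _ h => h.1

theorem List.Perm.drop_of_take {l w : List α} (h : l.Perm w) {i : ℕ}
    (hi : (l.take i).Perm (w.take i)) : (l.drop i).Perm (w.drop i) := by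
  rw [← List.take_append_drop i l, ← List.take_append_drop i w] at h
  exact (List.perm_append_left_iff _).1 ((hi.symm.append_right _).trans h)

/-- Reversing the second word exchanges the two ways of joining blocks, so a crosswise outermost
split becomes a straight one. -/
theorem separableWords_eq_union {w : List α} (hw : 2 ≤ w.length) :
    separableWords w = decomposableWords w ∪ List.reverse '' decomposableWords w := by
  ext l
  constructor
  · intro h
    obtain ⟨i, hi, hi', hp | hp⟩ := SeparablePair.exists_split h hw
    · exact .inl ⟨h, i, hi, hi', hp⟩
    · refine .inr ⟨l.reverse, ⟨SeparablePair.reverse_right h, w.length - i, by omega, by omega, ?_⟩,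
        l.reverse_reverse⟩
      have hl := SeparablePair.length_eq h
      have hp' : l.Perm w := SeparablePair.perm h
      rw [← hl, List.take_reverse, hl, Nat.sub_sub_self hi'.le]
      refine (List.reverse_perm _).trans ?_
      have h2 : (l.take i ++ l.drop i).Perm (w.drop (w.length - i) ++ w.take (w.length - i)) := by
        rw [List.take_append_drop]
        refine hp'.trans ?_
        refine .trans ?_ List.perm_append_comm
        rw [List.take_append_drop]
      exact (List.perm_append_left_iff _).1 ((hp.symm.append_right _).trans h2)
  · rintro (h | ⟨l, h, rfl⟩)
    · exact h.1
    · exact h.1.reverse_right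

theorem List.Nodup.not_mem_take_drop {l : List α} (h : l.Nodup) {a b : ℕ} (hab : a ≤ b) {x : α}
    (h1 : x ∈ l.take a) (h2 : x ∈ l.drop b) : False :=
  List.disjoint_take_drop h hab h1 h2

/-- If `l` and its reversal were both decomposable, the first letter of `w` would lie both in an
initial and in a final segment of `l`, and the last letter in the two complementary segments. One of
these two pairs of segments is disjoint. -/
theorem disjoint_decomposableWords {w : List α} (hn : w.Nodup) :
    Disjoint (decomposableWords w) (List.reverse '' decomposableWords w) := by
  rw [Set.disjoint_left]
  rintro _ ⟨hl, i, hi, hi', hp⟩ ⟨l, ⟨hl', j, hj, hj', hq⟩, rfl⟩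
  have hlen := hl'.length_eq
  have hln : l.Nodup := hl'.perm.nodup_iff.2 hn
  have hne : w ≠ [] := by rintro rfl; simp at hi'
  have hp' := hl.perm.drop_of_take hp
  have hq' := hl'.perm.drop_of_take hq
  rw [List.take_reverse] at hp
  rw [List.drop_reverse] at hp'
  have h1 : w.head hne ∈ w.take i := List.mem_take_iff_getElem.2 ⟨0, by omega, by
    rw [List.head_eq_getElem]⟩
  have h2 : w.head hne ∈ w.take j := List.mem_take_iff_getElem.2 ⟨0, by omega, by
    rw [List.head_eq_getElem]⟩
  have h3 : ∀ k < w.length, w.getLast hne ∈ w.drop k := by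
    intro k hk
    rw [← List.getLast_drop (by simpa using hk)]
    exact List.getLast_mem _
  have m1 := (List.mem_reverse.1 (hp.symm.subset h1))
  have m2 := hq.symm.subset h2
  have m3 := (List.mem_reverse.1 (hp'.symm.subset (h3 i hi')))
  have m4 := hq'.symm.subset (h3 j hj')
  rcases le_total j (l.length - i) with h | h
  · exact hln.not_mem_take_drop h m2 m1
  · exact hln.not_mem_take_drop h m3 m4

theorem ncard_separableWords_eq_two_mul {w : List α} (hn : w.Nodup) (hw : 2 ≤ w.length) :
    (separableWords w).ncard = 2 * (decomposableWords w).ncard := by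
  have hf := (finite_separableWords w).subset (decomposableWords_subset w)
  rw [separableWords_eq_union hw, Set.ncard_union_eq (disjoint_decomposableWords hn) hf
    (hf.image _), Set.ncard_image_of_injective _ List.reverse_injective, two_mul]

theorem separableWords_singleton (a : α) : separableWords [a] = {[a]} := by
  ext l
  constructor
  · intro h
    simpa using SeparablePair.perm h
  · rintro rfl
    exact .single a

/-- For length at least 2 exactly half of the separable words are decomposable. A one-letter word is
its own only partner and is indecomposable, hence the correction term. -/
theorem two_mul_ncard_indecomposable {w : List α} (hn : w.Nodup) (hw : 1 ≤ w.length) :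
    2 * (separableWords w \ decomposableWords w).ncard =
      (separableWords w).ncard + if w.length = 1 then 1 else 0 := by
  have hf := (finite_separableWords w).subset (decomposableWords_subset w)
  rw [Set.ncard_sdiff (decomposableWords_subset w) hf]
  split_ifs with h
  · obtain ⟨a, rfl⟩ := List.length_eq_one_iff.1 h
    have : decomposableWords [a] = ∅ := by
      ext l
      simp only [decomposableWords, List.length_singleton, Set.mem_ofPred_eq, Set.mem_empty_iff_false,
        iff_false, not_and, not_exists]
      intros
      omega
    simp [this, separableWords_singleton]
  · rw [ncard_separableWords_eq_two_mul hn (by omega)]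
    omega

/-- Cut at the shortest common initial block: minimality is the same as indecomposability of that
block, while the remainder is arbitrary. -/
theorem decomposableWords_eq_iUnion {w : List α} (hn : w.Nodup) :
    decomposableWords w = ⋃ i ∈ Finset.Ioo 0 w.length,
      Set.image2 (· ++ ·) (separableWords (w.take i) \ decomposableWords (w.take i))
        (separableWords (w.drop i)) := by
  classical
  have hsplit : ∀ l : List α, SeparablePair w l → ∀ i, (l.take i).Perm (w.take i) →
      SeparablePair (w.take i) (l.take i) ∧ SeparablePair (w.drop i) (l.drop i) := by
    intro l hl i hi
    refine SeparablePair.split ?_ ?_ hi (hl.perm.drop_of_take hi)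
    · simpa using hl
    · simpa using hn
  ext l
  simp only [Set.mem_iUnion, Set.mem_image2, Finset.mem_Ioo, exists_prop]
  constructor
  · rintro ⟨hl, hex⟩
    obtain ⟨hi, hi', hp⟩ := Nat.find_spec hex
    have hmin := fun j => @Nat.find_min _ _ hex j
    set i := Nat.find hex
    refine ⟨i, ⟨hi, hi'⟩, l.take i, ⟨(hsplit l hl i hp).1, ?_⟩, l.drop i, (hsplit l hl i hp).2, by simp⟩
    rintro ⟨-, j, hj, hj', hq⟩
    rw [List.length_take] at hj'
    refine hmin j (by omega) ⟨hj, by omega, ?_⟩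
    rwa [List.take_take, List.take_take, min_eq_left (by omega)] at hq
  · rintro ⟨i, ⟨hi, hi'⟩, x, ⟨hx, -⟩, y, hy, rfl⟩
    have hxl := SeparablePair.length_eq hx
    rw [List.length_take, min_eq_left hi'.le] at hxl
    refine ⟨?_, i, hi, hi', ?_⟩
    · have := SeparablePair.plus hx hy
      rwa [List.take_append_drop] at this
    · rw [← hxl, List.take_left, hxl]
      exact SeparablePair.perm hx

theorem ncard_decomposableWords {w : List α} (hn : w.Nodup) :
    (decomposableWords w).ncard = ∑ i ∈ Finset.Ioo 0 w.length,
      (separableWords (w.take i) \ decomposableWords (w.take i)).ncard *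
        (separableWords (w.drop i)).ncard := by
  have hlen : ∀ i ∈ Finset.Ioo 0 w.length, ∀ x ∈ separableWords (w.take i) \
      decomposableWords (w.take i), x.length = i := by
    intro i hi x hx
    rw [Finset.mem_Ioo] at hi
    rw [SeparablePair.length_eq hx.1, List.length_take, min_eq_left hi.2.le]
  -- The cut is unique: a shorter cut of the same word would decompose the longer first block.
  have hlt : ∀ i j, i < j → ∀ x ∈ separableWords (w.take i) \ decomposableWords (w.take i),
      ∀ x' ∈ separableWords (w.take j) \ decomposableWords (w.take j), ∀ y y' : List α,
      i ∈ Finset.Ioo 0 w.length → j ∈ Finset.Ioo 0 w.length → x ++ y = x' ++ y' → False := by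
    intro i j hij x hx x' hx' y y' hi hj he
    have hj' := Finset.mem_Ioo.1 hj
    refine hx'.2 ⟨hx'.1, i, (Finset.mem_Ioo.1 hi).1, by rw [List.length_take]; omega, ?_⟩
    have h1 := congrArg (List.take i) he
    rw [List.take_append_of_le_length (hlen i hi x hx).ge,
      List.take_append_of_le_length (by rw [hlen j hj x' hx']; exact hij.le),
      List.take_of_length_le (hlen i hi x hx).le] at h1
    rw [← h1, List.take_take, min_eq_left hij.le]
    exact SeparablePair.perm hx.1
  have hfin : ∀ i, (Set.image2 (· ++ ·) (separableWords (w.take i) \ decomposableWords (w.take i))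
        (separableWords (w.drop i))).Finite := fun i =>
    ((finite_separableWords _).subset Set.sdiff_subset).image2 _ (finite_separableWords _)
  rw [decomposableWords_eq_iUnion hn]
  have := Set.Finite.ncard_biUnion (Finset.Ioo 0 w.length).finite_toSet
    (s := fun i => Set.image2 (· ++ ·) (separableWords (w.take i) \ decomposableWords (w.take i))
        (separableWords (w.drop i))) (fun i _ => hfin i) ?_
  · rw [finsum_mem_coe_finset] at this
    refine this.trans (Finset.sum_congr rfl fun i hi => ?_)
    rw [← Set.image_uncurry_prod, Set.InjOn.ncard_image, Set.ncard_prod]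
    rintro ⟨x, y⟩ ⟨hx, -⟩ ⟨x', y'⟩ ⟨hx', -⟩ he
    have := List.append_inj he ((hlen i hi x hx).trans (hlen i hi x' hx').symm)
    exact Prod.ext this.1 this.2
  · intro i hi j hj hij
    rw [Function.onFun, Set.disjoint_left]
    rintro _ ⟨x, hx, y, -, rfl⟩ ⟨x', hx', y', -, he⟩
    rcases lt_or_gt_of_ne hij with h | h
    · exact hlt i j h x hx x' hx' y y' hi hj he.symm
    · exact hlt j i h x' hx' x hx y' y hj hi he

theorem ncard_separableWords (k : ℕ) : ∀ w : List α, w.Nodup → w.length = k + 1 →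
    (separableWords w).ncard = k.largeSchroder := by
  induction k using Nat.strong_induction_on with
  | _ k ih =>
    intro w hn hw
    obtain _ | k := k
    · obtain ⟨a, rfl⟩ := List.length_eq_one_iff.1 hw
      simp [separableWords_singleton]
    rw [ncard_separableWords_eq_two_mul hn (by omega), ncard_decomposableWords hn, Finset.mul_sum,
      Nat.largeSchroder_succ]
    have h1 : ∀ i ∈ Finset.Ioo 0 w.length, 2 * ((separableWords (w.take i) \
        decomposableWords (w.take i)).ncard * (separableWords (w.drop i)).ncard) =
        (Nat.largeSchroder (i - 1) + if i = 1 then 1 else 0) * Nat.largeSchroder (k + 1 - i) := by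
      intro i hi
      rw [Finset.mem_Ioo] at hi
      have hl : (w.take i).length = i := by rw [List.length_take]; omega
      rw [← mul_assoc, two_mul_ncard_indecomposable (hn.sublist (List.take_sublist _ _)) (by omega),
        ih (i - 1) (by omega) _ (hn.sublist (List.take_sublist _ _)) (by omega),
        ih (k + 1 - i) (by omega) _ (hn.sublist (List.drop_sublist _ _)) (by rw [List.length_drop]; omega),
        hl]
    rw [Finset.sum_congr rfl h1, hw]
    have h2 : Finset.Ioo 0 (k + 1 + 1) = (Finset.range (k + 1)).image (· + 1) := by
      ext i
      simp only [Finset.mem_Ioo, Finset.mem_image, Finset.mem_range]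
      constructor
      · intro h
        exact ⟨i - 1, by omega, by omega⟩
      · rintro ⟨j, hj, rfl⟩
        omega
    rw [h2, Finset.sum_image (by intro a _ b _ h; simpa using h)]
    -- The correction at block length 1 contributes the linear term of the Schröder recurrence, and
    -- the rest is its convolution.
    simp only [Nat.add_sub_cancel, add_mul, Finset.sum_add_distrib, Nat.add_eq_right, ite_mul,
      one_mul, zero_mul, Nat.add_sub_add_right]
    rw [Finset.sum_ite_eq' (Finset.range (k + 1)) 0 (fun x => Nat.largeSchroder (k - x))]
    simp only [Finset.mem_range, Nat.succ_pos', if_true, Nat.sub_zero]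
    rw [add_comm, ← Nat.Iio_eq_range, Finset.Iio_add_one_eq_Iic]

end Counting

/-! ### Growth of the Schröder numbers and the logarithm of the density -/

section SchroderGrowth

-- The quadratic equation of the generating series f says that g = 1 - X - 2Xf is a square root of 1
-- - 6X + X². Differentiating g² and multiplying by g gives a linear differential equation with
-- polynomial coefficients; its coefficients are the recurrence.
open PowerSeries in
theorem Nat.largeSchroder_three_term (n : ℕ) :
    (n + 4) * Nat.largeSchroder (n + 3) + (n + 1) * Nat.largeSchroder (n + 1) =
      (6 * n + 15) * Nat.largeSchroder (n + 2) := by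
  let f : ℤ⟦X⟧ := PowerSeries.map (Nat.castRingHom ℤ) largeSchroderSeries
  have hf : f = 1 + X * f + X * f ^ 2 := by
    have := congrArg (PowerSeries.map (Nat.castRingHom ℤ))
      largeSchroderSeries_eq_one_add_X_mul_largeSchroderSeries_add_X_mul_largeSchroderSeries_sq
    simpa [f] using this
  have hc : ∀ k, coeff k f = (Nat.largeSchroder k : ℤ) := fun k => by simp [f]
  clear_value f
  obtain ⟨g, hg⟩ : ∃ g : ℤ⟦X⟧, g = 1 - X - (2 : ℤ) • (X * f) := ⟨_, rfl⟩
  have hgg : g * g = 1 - X * (6 : ℤ⟦X⟧) + X * X := by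
    rw [hg, zsmul_eq_mul]
    push_cast
    linear_combination -4 * X * hf
  have hd : (2 : ℤ⟦X⟧) * (derivative ℤ g * (1 - X * (6 : ℤ⟦X⟧) + X * X)) =
      (2 : ℤ⟦X⟧) * (g * (X - 3)) := by
    have h := congrArg (derivative ℤ) hgg
    have h6 : derivative ℤ (6 : ℤ⟦X⟧) = 0 := by
      simpa using (derivative ℤ).map_natCast 6
    simp only [Derivation.leibniz, map_add, map_sub, derivative_X, smul_eq_mul, h6,
      Derivation.map_one_eq_zero] at h
    rw [← hgg]
    linear_combination g * h
  have hgc : ∀ k, coeff (k + 2) g = -2 * (Nat.largeSchroder (k + 1) : ℤ) := by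
    intro k
    rw [hg, map_sub, map_sub, map_zsmul, coeff_succ_X_mul, hc, coeff_one, coeff_X]
    simp
  have h2 := mul_left_cancel₀ (fun h => by simpa [map_ofNat] using congrArg constantCoeff h) hd
  have h3 := congrArg (coeff (n + 3)) h2
  have e1 : derivative ℤ g * (1 - X * (6 : ℤ⟦X⟧) + X * X) =
      derivative ℤ g - X * ((6 : ℤ) • derivative ℤ g) + X * (X * derivative ℤ g) := by
    rw [zsmul_eq_mul]
    push_cast
    ring
  have e2 : g * (X - 3) = X * g - (3 : ℤ) • g := by
    rw [zsmul_eq_mul]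
    push_cast
    ring
  rw [e1, e2] at h3
  simp only [map_add, map_sub, coeff_succ_X_mul, map_zsmul, coeff_derivative, smul_eq_mul] at h3
  rw [show n + 3 + 1 = n + 2 + 2 from rfl, show n + 2 + 1 = n + 1 + 2 from rfl,
    show n + 1 + 1 = n + 2 from rfl, show n + 3 = n + 1 + 2 from rfl, hgc, hgc, hgc] at h3
  push_cast at h3
  zify
  refine mul_left_cancel₀ (two_ne_zero' ℤ) ?_
  linear_combination -h3

/-- The growth rate of the Schröder numbers. -/
noncomputable def schroderRate : ℝ := 3 + Real.sqrt 8

theorem schroderRate_sq : schroderRate * schroderRate = 6 * schroderRate - 1 := by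
  have := Real.mul_self_sqrt (show (0 : ℝ) ≤ 8 by norm_num)
  unfold schroderRate
  linear_combination this

theorem five_lt_schroderRate : 5 < schroderRate := by
  have : (2 : ℝ) < Real.sqrt 8 := Real.lt_sqrt_of_sq_lt (by norm_num)
  unfold schroderRate
  linarith

theorem schroderRate_lt_six : schroderRate < 6 := by
  have : Real.sqrt 8 < 3 := by rw [Real.sqrt_lt' (by norm_num)]; norm_num
  unfold schroderRate
  linarith

theorem Nat.largeSchroder_three_term_real (n : ℕ) :
    ((n : ℝ) + 4) * Nat.largeSchroder (n + 3) + (n + 1) * Nat.largeSchroder (n + 1) =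
      (6 * n + 15) * Nat.largeSchroder (n + 2) := by
  exact_mod_cast Nat.largeSchroder_three_term n

/-- The weights n+1 and n+3 make the ratio bound inductive: after inserting it in the three-term
recurrence, the slack is (ρ - 3) L_{n+2} with ρ the rate. -/
theorem schroderRate_mul_largeSchroder_le (n : ℕ) :
    schroderRate * ((n + 1) * Nat.largeSchroder (n + 1)) ≤
      (n + 3) * Nat.largeSchroder (n + 2) := by
  have h5 := five_lt_schroderRate
  have h6 := schroderRate_lt_six
  induction n with
  | zero => norm_num; linarith
  | succ n ih =>
    have h := Nat.largeSchroder_three_term_real n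
    have hq := schroderRate_sq
    have hL : (0 : ℝ) ≤ Nat.largeSchroder (n + 2) := Nat.cast_nonneg _
    have h1 := mul_le_mul_of_nonneg_left ih (sub_nonneg.2 h6.le)
    -- The factor 6 - ρ is the conjugate root of x² = 6x - 1, hence the inverse of ρ.
    have h2 : (6 - schroderRate) * (schroderRate * (((n : ℝ) + 1) * Nat.largeSchroder (n + 1))) =
        (n + 1) * Nat.largeSchroder (n + 1) := by
      linear_combination -(((n : ℝ) + 1) * Nat.largeSchroder (n + 1)) * hq
    have h3 : 0 ≤ (schroderRate - 3) * (Nat.largeSchroder (n + 2) : ℝ) :=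
      mul_nonneg (by linarith) hL
    push_cast
    rw [show n + 1 + 1 = n + 2 from rfl, show n + 1 + 2 = n + 3 from rfl]
    linarith

theorem largeSchroder_succ_le (n : ℕ) :
    (Nat.largeSchroder (n + 1) : ℝ) ≤ schroderRate * Nat.largeSchroder n := by
  have h5 := five_lt_schroderRate
  have h6 := schroderRate_lt_six
  induction n with
  | zero => norm_num; linarith
  | succ n ih =>
    obtain _ | n := n
    · norm_num; linarith
    have h := Nat.largeSchroder_three_term_real n
    have hq := schroderRate_sq
    have hL : (0 : ℝ) ≤ Nat.largeSchroder (n + 2) := Nat.cast_nonneg _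
    have hn : (0 : ℝ) ≤ n + 1 := by positivity
    rw [show n + 1 + 1 = n + 2 from rfl] at *
    rw [show n + 2 + 1 = n + 3 from rfl]
    have h1 := mul_le_mul_of_nonneg_left (mul_le_mul_of_nonneg_left ih (sub_nonneg.2 h6.le)) hn
    have h2 : (6 - schroderRate) * (schroderRate * (Nat.largeSchroder (n + 1) : ℝ)) =
        Nat.largeSchroder (n + 1) := by
      linear_combination -(Nat.largeSchroder (n + 1) : ℝ) * hq
    rw [h2] at h1
    have h3 : 0 ≤ (schroderRate - 3) * (Nat.largeSchroder (n + 2) : ℝ) :=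
      mul_nonneg (by linarith) hL
    refine le_of_mul_le_mul_left ?_ (show (0 : ℝ) < n + 4 by positivity)
    linarith

theorem largeSchroder_le_pow (n : ℕ) : (Nat.largeSchroder n : ℝ) ≤ schroderRate ^ n := by
  induction n with
  | zero => simp
  | succ n ih =>
    rw [pow_succ']
    exact (largeSchroder_succ_le n).trans
      (mul_le_mul_of_nonneg_left ih (by linarith [five_lt_schroderRate]))

/-- The right side equals 4 at `n = 0` and grows at least by the factor ρ at each step, by
`schroderRate_mul_largeSchroder_le`. -/
theorem pow_le_largeSchroder (n : ℕ) :
    4 * schroderRate ^ n ≤ (n + 1) * (n + 2) * Nat.largeSchroder (n + 1) := by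
  induction n with
  | zero => norm_num
  | succ n ih =>
    have h := schroderRate_mul_largeSchroder_le n
    have h0 : 0 ≤ schroderRate := by linarith [five_lt_schroderRate]
    have h1 := mul_le_mul_of_nonneg_left ih h0
    have h2 := mul_le_mul_of_nonneg_left h (show (0 : ℝ) ≤ n + 2 by positivity)
    rw [pow_succ']
    push_cast
    rw [show n + 1 + 1 = n + 2 from rfl]
    linarith

theorem largeSchroder_pos (n : ℕ) : 0 < Nat.largeSchroder n := by
  induction n with
  | zero => simp
  | succ n ih => rw [Nat.largeSchroder_succ]; omega

/-- Since ρ is close to 6, the bounds 1 - 1/x ≤ log x ≤ x - 1 at x = ρ/6 suffice, together with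
numerical values of log 2 and log 3. -/
theorem log_schroderRate_mem : Real.log schroderRate ∈ Set.Ioo (1.762 : ℝ) 1.764 := by
  have h1 : (2.8284 : ℝ) < Real.sqrt 8 := Real.lt_sqrt_of_sq_lt (by norm_num)
  have h2 : Real.sqrt 8 < 2.8285 := by rw [Real.sqrt_lt' (by norm_num)]; norm_num
  have hpos : 0 < schroderRate := by linarith [five_lt_schroderRate]
  have hinv : 6 / schroderRate = 6 * (6 - schroderRate) := by
    rw [div_eq_iff hpos.ne']
    linear_combination 6 * schroderRate_sq
  have h6 : Real.log 6 = Real.log 2 + Real.log 3 := by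
    rw [← Real.log_mul (by norm_num) (by norm_num)]
    norm_num
  have hu := Real.log_le_sub_one_of_pos (show 0 < schroderRate / 6 by positivity)
  have hl := Real.one_sub_inv_le_log_of_pos (show 0 < schroderRate / 6 by positivity)
  rw [inv_div, hinv] at hl
  rw [Real.log_div hpos.ne' (by norm_num), h6] at hu hl
  have hr : schroderRate = 3 + Real.sqrt 8 := rfl
  constructor <;> linarith [Real.log_two_gt_d9, Real.log_two_lt_d9, Real.log_three_gt_d9,
    Real.log_three_lt_d9]

theorem abs_rate_sub_lt :
    |(1 + Real.log 2 + Real.log (3 + Real.sqrt 8)) - 3.46| < 0.005 := by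
  have h := log_schroderRate_mem
  rw [schroderRate] at h
  rw [abs_lt]
  constructor <;> linarith [h.1, h.2, Real.log_two_gt_d9, Real.log_two_lt_d9]

/-- Both the polynomial factor of the lower bound and the index shift cost only a multiple of log N,
because log N ≥ 1. -/
theorem abs_log_largeSchroder_sub_le {N k : ℕ} (hN : 7 ≤ N) (hk : 2 ≤ k) (hkN : k ≤ N) :
    |Real.log (Nat.largeSchroder (k - 1)) - k * Real.log schroderRate| ≤ 6 * Real.log N := by
  obtain ⟨n, rfl⟩ : ∃ n, k = n + 2 := ⟨k - 2, by omega⟩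
  rw [show n + 2 - 1 = n + 1 by omega]
  have hpos : (0 : ℝ) < Nat.largeSchroder (n + 1) := by exact_mod_cast largeSchroder_pos _
  have h0 : 0 < schroderRate := by linarith [five_lt_schroderRate]
  have hl := log_schroderRate_mem
  have hlogN : 1 ≤ Real.log N := by
    rw [Real.le_log_iff_exp_le (by positivity)]
    have : (7 : ℝ) ≤ N := by exact_mod_cast hN
    linarith [Real.exp_one_lt_d9]
  have hu := Real.log_le_log hpos (largeSchroder_le_pow (n + 1))
  rw [Real.log_pow] at hu
  have hlo := Real.log_le_log (by positivity) (pow_le_largeSchroder n)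
  rw [Real.log_mul (by norm_num) (by positivity), Real.log_pow, Real.log_mul (by positivity)
    hpos.ne', Real.log_mul (by positivity) (by positivity)] at hlo
  have hkN' : (n : ℝ) + 2 ≤ N := by exact_mod_cast hkN
  have h1 : Real.log (n + 1) ≤ Real.log N := Real.log_le_log (by positivity) (by linarith)
  have h2 : Real.log (n + 2) ≤ Real.log N := Real.log_le_log (by positivity) (by linarith)
  have h4 : 0 ≤ Real.log 4 := Real.log_nonneg (by norm_num)
  push_cast at hu ⊢
  rw [abs_le]
  constructor <;> linarith [hl.1, hl.2]

theorem abs_log_factorial_sub_le {k : ℕ} (hk : 1 ≤ k) :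
    |Real.log k.factorial - (k * Real.log k - k)| ≤ Real.log k + 1 := by
  rw [abs_le]
  constructor
  · have h := Stirling.le_log_factorial_stirling (n := k) (by omega)
    have h1 : 0 ≤ Real.log k := Real.log_nonneg (by exact_mod_cast hk)
    have h2 : 0 ≤ Real.log (2 * Real.pi) := Real.log_nonneg (by linarith [Real.pi_gt_three])
    linarith
  · induction k, hk using Nat.le_induction with
    | base => simp
    | succ k hk ih =>
      have hk0 : (0 : ℝ) < k := by exact_mod_cast hk
      have h1 := Real.one_sub_inv_le_log_of_pos (show (0 : ℝ) < (k + 1) / k by positivity)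
      rw [Real.log_div (by positivity) (by positivity)] at h1
      have h2 := mul_le_mul_of_nonneg_left h1 (show (0 : ℝ) ≤ k + 1 by positivity)
      -- The induction needs (k+1) log((k+1)/k) ≥ 1, which is `h2` after this simplification.
      have h3 : ((k : ℝ) + 1) * (1 - ((k + 1) / k : ℝ)⁻¹) = 1 := by
        field_simp
        ring
      rw [Nat.factorial_succ]
      push_cast
      rw [Real.log_mul (by positivity) (by positivity)]
      linarith

/-- As 2k is within 4 of N, replacing log k by log N - log 2 changes k log k by at most N/2 - k ≤ 2.
-/
theorem abs_log_factorial_sub_le' {N k : ℕ} (hN : 7 ≤ N) (hk : 2 ≤ k) (hkN : 2 * k ≤ N)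
    (hNk : N ≤ 2 * k + 4) :
    |Real.log k.factorial - (k * Real.log N - k * Real.log 2 - k)| ≤ 4 * Real.log N := by
  have h := abs_log_factorial_sub_le (k := k) (by omega)
  have hlogN : 1 ≤ Real.log N := by
    rw [Real.le_log_iff_exp_le (by positivity)]
    have : (7 : ℝ) ≤ N := by exact_mod_cast hN
    linarith [Real.exp_one_lt_d9]
  have hk0 : (0 : ℝ) < k := by exact_mod_cast (by omega : 0 < k)
  have hN0 : (0 : ℝ) < N := by exact_mod_cast (by omega : 0 < N)
  have hkN' : 2 * (k : ℝ) ≤ N := by exact_mod_cast hkN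
  have hNk' : (N : ℝ) ≤ 2 * k + 4 := by exact_mod_cast hNk
  have h1 := Real.log_le_sub_one_of_pos (show (0 : ℝ) < N / (2 * k) by positivity)
  have h2 : 0 ≤ Real.log (N / (2 * k)) := Real.log_nonneg (by rw [le_div_iff₀ (by positivity)]; linarith)
  rw [Real.log_div hN0.ne' (by positivity), Real.log_mul (by norm_num) hk0.ne'] at h1 h2
  have h3 := mul_le_mul_of_nonneg_left h1 hk0.le
  have h4 := mul_nonneg hk0.le h2
  have h5 : (k : ℝ) * (N / (2 * k) - 1) ≤ 2 := by
    have : (k : ℝ) * (N / (2 * k) - 1) = N / 2 - k := by field_simp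
    linarith
  have h6 : Real.log k ≤ Real.log N := Real.log_le_log hk0 (by linarith)
  rw [abs_le] at h ⊢
  constructor <;> linarith [h.1, h.2]

theorem exists_abs_log_density_sub_le : ∃ C : ℝ, ∀ N k l : ℕ, 7 ≤ N → k + l + 3 = N →
    N ≤ 2 * k + 4 → N ≤ 2 * l + 4 →
    |Real.log ((Nat.largeSchroder (k - 1) * Nat.largeSchroder (l - 1) : ℝ) /
      (k.factorial * l.factorial)) -
        (-(N * (Real.log N - (1 + Real.log 2 + Real.log (3 + Real.sqrt 8)))))| ≤
        C * Real.log N := by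
  -- The errors are 6 + 6 from the Schröder numbers, 4 + 4 from the factorials, and 3 log N - 3c
  -- from k + l = N - 3. Their sum stays below 34 log N.
  refine ⟨40, fun N k l hN hkl hk hl => ?_⟩
  have hlogN : 1 ≤ Real.log N := by
    rw [Real.le_log_iff_exp_le (by positivity)]
    have : (7 : ℝ) ≤ N := by exact_mod_cast hN
    linarith [Real.exp_one_lt_d9]
  have hL1 : (0 : ℝ) < Nat.largeSchroder (k - 1) := by exact_mod_cast largeSchroder_pos _
  have hL2 : (0 : ℝ) < Nat.largeSchroder (l - 1) := by exact_mod_cast largeSchroder_pos _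
  rw [Real.log_div (by positivity) (by positivity), Real.log_mul (by positivity) (by positivity),
    Real.log_mul (by positivity) (by positivity)]
  have a1 := abs_log_largeSchroder_sub_le (N := N) (k := k) hN (by omega) (by omega)
  have a2 := abs_log_largeSchroder_sub_le (N := N) (k := l) hN (by omega) (by omega)
  have a3 := abs_log_factorial_sub_le' (N := N) (k := k) hN (by omega) (by omega) hk
  have a4 := abs_log_factorial_sub_le' (N := N) (k := l) hN (by omega) (by omega) hl
  have hr := abs_rate_sub_lt
  have hN' : (k : ℝ) + l + 3 = N := by exact_mod_cast hkl
  rw [schroderRate] at a1 a2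
  generalize Real.log (3 + Real.sqrt 8) = r at *
  generalize Real.log (N : ℝ) = x at *
  generalize Real.log 2 = y at *
  rw [abs_le] at *
  rw [abs_lt] at hr
  rw [← hN']
  have e : ((k : ℝ) + l + 3) * (x - (1 + y + r)) =
    (k * x - k * y - k) + (l * x - l * y - l) - k * r - l * r + 3 * x - 3 * (1 + y + r) := by ring
  rw [e]
  constructor <;> linarith [hr.1, hr.2, a1.1, a1.2, a2.1, a2.2, a3.1, a3.2, a4.1, a4.2]

end SchroderGrowth

/-! ### Embedded cubic trees as plane binary trees -/

section FaceWalks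

/-- Plane binary trees with leaves in `A` and internal vertices in `I`. -/
inductive PlaneTree (A I : Type) : Type
  | leaf (a : A) : PlaneTree A I
  | node (j : I) (l r : PlaneTree A I) : PlaneTree A I

/-- The leaves of a plane tree from left to right. -/
def PlaneTree.word {A I : Type} : PlaneTree A I → List A
  | leaf a => [a]
  | node _ l r => l.word ++ r.word

variable {A I : Type} {G : SimpleGraph (A ⊕ I)} (R : RotationSystem G)

namespace RotationSystem

/-- The part of the embedded graph beyond the dart `d` is the plane tree `t`. -/
inductive Unfolds : G.Dart → PlaneTree A I → Prop
  | leaf {d : G.Dart} {a : A} : d.snd = Sum.inl a → Unfolds d (.leaf a)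
  | node {d : G.Dart} {j : I} {l r : PlaneTree A I} : d.snd = Sum.inr j →
      Unfolds (R.rot d.symm) l → Unfolds (R.rot (R.rot d.symm)) r → Unfolds d (.node j l r)

/-- Running along faces from the dart `d` to the dart `e` one meets the leaves `w`. -/
inductive FaceWalk : G.Dart → G.Dart → List A → Prop
  | refl (d : G.Dart) : FaceWalk d d []
  | leaf {d e : G.Dart} {a : A} {w : List A} : (R.faceStep d).fst = Sum.inl a →
      FaceWalk (R.faceStep d) e w → FaceWalk d e (a :: w)
  | node {d e : G.Dart} {j : I} {w : List A} : (R.faceStep d).fst = Sum.inr j →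
      FaceWalk (R.faceStep d) e w → FaceWalk d e w

variable {R}

theorem FaceWalk.trans {d e f : G.Dart} {v w : List A} (h : R.FaceWalk d e v)
    (h' : R.FaceWalk e f w) : R.FaceWalk d f (v ++ w) := by
  induction h with
  | refl => exact h'
  | leaf ha _ ih => exact .leaf ha (ih h')
  | node hj _ ih => exact .node hj (ih h')

theorem faceStep_fst (d : G.Dart) : (R.faceStep d).fst = d.snd := R.fst_rot _

theorem finite_darts {v : A ⊕ I} : Set.BijOn (fun d : G.Dart => d.snd) {d | d.fst = v}
    (G.neighborSet v) := by
  refine ⟨?_, ?_, ?_⟩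
  · rintro d rfl
    exact d.adj
  · rintro ⟨⟨a, b⟩, h⟩ hd ⟨⟨a', b'⟩, h'⟩ hd' he
    obtain rfl : a = v := hd
    obtain rfl : a' = a := hd'
    obtain rfl : b = b' := he
    rfl
  · intro u hu
    exact ⟨⟨(v, u), hu⟩, rfl, rfl⟩

theorem ncard_darts (v : A ⊕ I) : {d : G.Dart | d.fst = v}.ncard = (G.neighborSet v).ncard := by
  rw [← finite_darts.image_eq, finite_darts.injOn.ncard_image]

theorem dart_unique {v : A ⊕ I} (hv : (G.neighborSet v).ncard = 1) {d e : G.Dart}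
    (hd : d.fst = v) (he : e.fst = v) : d = e := by
  rw [← ncard_darts, Set.ncard_eq_one] at hv
  obtain ⟨f, hf⟩ := hv
  have h1 : d ∈ {d : G.Dart | d.fst = v} := hd
  have h2 : e ∈ {d : G.Dart | d.fst = v} := he
  rw [hf] at h1 h2
  exact h1.trans h2.symm

theorem rot_eq_self {v : A ⊕ I} (hv : (G.neighborSet v).ncard = 1) {d : G.Dart} (hd : d.fst = v) :
    R.rot d = d :=
  dart_unique hv ((R.fst_rot d).trans hd) hd

/-- A fixed dart or a cycle of length two would leave some of the three darts at the vertex out of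
its single cycle. -/
theorem rot_cubic {v : A ⊕ I} (hv : (G.neighborSet v).ncard = 3) {d : G.Dart} (hd : d.fst = v) :
    R.rot d ≠ d ∧ R.rot (R.rot d) ≠ d ∧ R.rot (R.rot (R.rot d)) = d ∧
      ∀ e : G.Dart, e.fst = v → e = d ∨ e = R.rot d ∨ e = R.rot (R.rot d) := by
  rw [← ncard_darts] at hv
  have hfin : {d : G.Dart | d.fst = v}.Finite := Set.finite_of_ncard_ne_zero (by omega)
  have h1 : R.rot d ≠ d := by
    intro h
    have hs : {d : G.Dart | d.fst = v} ⊆ {d} := by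
      intro e he
      obtain ⟨i, rfl⟩ := R.cyclic d e (hd.trans (Eq.symm he))
      exact Equiv.Perm.zpow_apply_eq_self_of_apply_eq_self h i
    have := Set.ncard_le_ncard hs
    rw [Set.ncard_singleton] at this
    omega
  have h2 : R.rot (R.rot d) ≠ d := by
    intro h
    have hs : {d : G.Dart | d.fst = v} ⊆ {d, R.rot d} := by
      intro e he
      obtain ⟨i, rfl⟩ := R.cyclic d e (hd.trans (Eq.symm he))
      exact Equiv.Perm.zpow_apply_eq_of_apply_apply_eq_self h i
    have := (Set.ncard_le_ncard hs).trans (Set.ncard_insert_le _ _)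
    rw [Set.ncard_singleton] at this
    omega
  have hall : {d, R.rot d, R.rot (R.rot d)} = {d : G.Dart | d.fst = v} := by
    refine Set.eq_of_subset_of_ncard_le ?_ ?_ hfin
    · rintro e (rfl | rfl | rfl)
      · exact hd
      · exact (R.fst_rot _).trans hd
      · exact (R.fst_rot _).trans ((R.fst_rot _).trans hd)
    · rw [hv, Set.ncard_eq_three.2 ⟨d, R.rot d, R.rot (R.rot d), h1.symm, h2.symm,
        fun h => h1 (R.rot.injective h.symm), rfl⟩]
  refine ⟨h1, h2, ?_, fun e he => ?_⟩
  · have : R.rot (R.rot (R.rot d)) ∈ {d : G.Dart | d.fst = v} :=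
      (R.fst_rot _).trans ((R.fst_rot _).trans ((R.fst_rot _).trans hd))
    rw [← hall] at this
    rcases this with h | h | h
    · exact h
    · exact absurd (R.rot.injective h) h2
    · exact absurd (R.rot.injective (R.rot.injective h)) h1
  · have : e ∈ {d : G.Dart | d.fst = v} := he
    rw [← hall] at this
    exact this

/-- The boundary walk is the depth-first tour: it enters along `d`, visits the leaves from left to
right, and leaves along the reversed dart. -/
theorem Unfolds.faceWalk (hA : ∀ a : A, (G.neighborSet (Sum.inl a)).ncard = 1)
    (hI : ∀ j : I, (G.neighborSet (Sum.inr j)).ncard = 3) {d : G.Dart} {t : PlaneTree A I}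
    (h : R.Unfolds d t) : R.FaceWalk d d.symm t.word := by
  induction h with
  | @leaf d a ha =>
    have h : R.faceStep d = d.symm := rot_eq_self (hA a) ha
    refine .leaf (a := a) ((faceStep_fst d).trans ha) ?_
    rw [h]
    exact .refl _
  | @node d j l r hj hl hr ihl ihr =>
    obtain ⟨-, -, h3, -⟩ := R.rot_cubic (hI j) (d := d.symm) hj
    have hf1 : (R.rot d.symm).fst = Sum.inr j := (R.fst_rot _).trans hj
    have hf2 : (R.rot (R.rot d.symm)).fst = Sum.inr j := (R.fst_rot _).trans hf1
    have hf3 : (R.rot (R.rot (R.rot d.symm))).fst = Sum.inr j := (R.fst_rot _).trans hf2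
    -- These are the three corners at the vertex; the last one leads back to `d.symm` because the
    -- rotation has order three there.
    have w1 : R.FaceWalk d (R.rot d.symm) [] := .node (j := j) hf1 (.refl _)
    have w2 : R.FaceWalk (R.rot d.symm).symm (R.rot (R.rot d.symm)) [] := by
      refine .node (j := j) ?_ ?_ <;> rw [faceStep, SimpleGraph.Dart.symm_symm]
      · exact hf2
      · exact .refl _
    have w3 : R.FaceWalk (R.rot (R.rot d.symm)).symm d.symm [] := by
      refine .node (j := j) ?_ ?_ <;> rw [faceStep, SimpleGraph.Dart.symm_symm]
      · exact hf3
      · rw [h3]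
        exact .refl _
    have := w1.trans ((ihl.trans w2).trans (ihr.trans w3))
    simpa [PlaneTree.word] using this

end RotationSystem

namespace SimpleGraph

/-- Two parents would extend to two distinct paths from the root. This makes "pointing away from the
root" well behaved for darts. -/
theorem IsTree.neighbor_unique_of_dist {V : Type*} {G : SimpleGraph V} (hG : G.IsTree)
    {r u u' v : V} (h : G.Adj u v) (h' : G.Adj u' v) (hd : G.dist r v = G.dist r u + 1)
    (hd' : G.dist r v = G.dist r u' + 1) : u = u' := by
  obtain ⟨p, -, hp⟩ := (hG.connected r u).exists_path_of_dist
  obtain ⟨p', -, hp'⟩ := (hG.connected r u').exists_path_of_dist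
  have h1 : (p.concat h).IsPath := Walk.isPath_of_length_eq_dist _ (by simp [hp, hd])
  have h2 : (p'.concat h').IsPath := Walk.isPath_of_length_eq_dist _ (by simp [hp', hd'])
  have := (hG.existsUnique_path r v).unique h1 h2
  simpa using congrArg Walk.penultimate this

theorem dist_lt_card {V : Type*} [Fintype V] {G : SimpleGraph V} (hG : G.Connected) (u v : V) :
    G.dist u v < Fintype.card V := by
  obtain ⟨p, hp, h⟩ := (hG u v).exists_path_of_dist
  rw [← h]
  exact hp.length_lt

end SimpleGraph

/-- Both embeddings are unfolded at once, beyond a dart pointing away from the root `v`. Distance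
from `v` grows along such darts and is bounded, so the recursion ends. That `v` itself is not met is
needed later to recognise one full turn around the tree. -/
theorem RotationSystem.exists_unfolds [Fintype A] [Fintype I] (hG : G.IsTree)
    (hI : ∀ j : I, (G.neighborSet (Sum.inr j)).ncard = 3) (R₁ R₂ : RotationSystem G)
    (v : A ⊕ I) (k : ℕ) : ∀ d : G.Dart, G.dist v d.snd = G.dist v d.fst + 1 →
      Fintype.card (A ⊕ I) - G.dist v d.snd = k → ∃ t₁ t₂ : PlaneTree A I,
      R₁.Unfolds d t₁ ∧ R₂.Unfolds d t₂ ∧ SeparablePair t₁.word t₂.word ∧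
      ∀ a ∈ t₁.word, Sum.inl a ≠ v := by
  induction k using Nat.strong_induction_on with
  | _ k ih =>
    intro d hd hk
    cases hv : d.snd with
    | inl a =>
      refine ⟨.leaf a, .leaf a, .leaf hv, .leaf hv, .single a, ?_⟩
      simp only [PlaneTree.word, List.mem_singleton, forall_eq]
      rintro rfl
      rw [hv, SimpleGraph.dist_self] at hd
      omega
    | inr j =>
      -- Any dart out of this vertex other than the one back again points away from `v`, since the
      -- parent is unique.
      have step : ∀ e : G.Dart, e.fst = d.snd → e ≠ d.symm → ∃ t₁ t₂ : PlaneTree A I,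
          R₁.Unfolds e t₁ ∧ R₂.Unfolds e t₂ ∧ SeparablePair t₁.word t₂.word ∧
          ∀ a ∈ t₁.word, Sum.inl a ≠ v := by
        intro e he hne
        have he' : G.dist v e.snd = G.dist v e.fst + 1 := by
          rcases hG.dist_eq_dist_add_one_of_adj v e.adj with h | h
          · refine absurd ?_ hne
            refine SimpleGraph.Dart.ext _ _ (Prod.ext he ?_)
            refine hG.neighbor_unique_of_dist (r := v) e.adj.symm ?_ h ?_
            · rw [he]; exact d.adj
            · rw [he]; exact hd
          · exact h
        have := SimpleGraph.dist_lt_card hG.connected v e.snd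
        refine ih _ ?_ e he' rfl
        rw [he', he] at this ⊢
        omega
      obtain ⟨a1, a2, a3, a4⟩ := R₁.rot_cubic (hI j) (d := d.symm) hv
      obtain ⟨b1, b2, b3, b4⟩ := R₂.rot_cubic (hI j) (d := d.symm) hv
      have f1 : (R₁.rot d.symm).fst = d.snd := R₁.fst_rot _
      have f2 : (R₁.rot (R₁.rot d.symm)).fst = d.snd := (R₁.fst_rot _).trans f1
      have g1 : (R₂.rot d.symm).fst = d.snd := R₂.fst_rot _
      have g2 : (R₂.rot (R₂.rot d.symm)).fst = d.snd := (R₂.fst_rot _).trans g1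
      obtain ⟨s₁, s₂, hs₁, hs₂, hs, hs'⟩ := step _ f1 a1
      obtain ⟨t₁, t₂, ht₁, ht₂, ht, ht'⟩ := step _ f2 a2
      have hmem : ∀ a ∈ (PlaneTree.node j s₁ t₁).word, Sum.inl a ≠ v := by
        intro a ha
        rcases List.mem_append.1 ha with h | h
        · exact hs' a h
        · exact ht' a h
      have hne : R₂.rot (R₂.rot d.symm) ≠ R₂.rot d.symm := fun h => b1 (R₂.rot.injective h)
      -- The first branch for `R₂` is either the first or the second branch for `R₁`, giving `plus`
      -- or `minus` respectively.
      rcases a4 _ (g1.trans hv) with h | h | h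
      · exact absurd h b1
      · rcases a4 _ (g2.trans hv) with h' | h' | h'
        · exact absurd h' b2
        · exact absurd (h'.trans h.symm) hne
        · exact ⟨.node j s₁ t₁, .node j s₂ t₂, .node hv hs₁ ht₁,
            .node hv (by rwa [h]) (by rwa [h']), hs.plus ht, hmem⟩
      · rcases a4 _ (g2.trans hv) with h' | h' | h'
        · exact absurd h' b2
        · exact ⟨.node j s₁ t₁, .node j t₂ s₂, .node hv hs₁ ht₁,
            .node hv (by rwa [h]) (by rwa [h']), hs.minus ht, hmem⟩
        · exact absurd (h'.trans h.symm) hne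

end FaceWalks

/-! ### Reading the circular ordering off an embedding -/

section LeafOrder

variable {n k : ℕ} {G : SimpleGraph (Fin n ⊕ Fin k)} {R : RotationSystem G}

namespace RotationSystem

theorem FaceWalk.exists_iterate {d e : G.Dart} {w : List (Fin n)} (h : R.FaceWalk d e w) :
    ∀ b l, w = b :: l → ∃ t, 0 < t ∧ (R.faceStep^[t] d).fst = Sum.inl b ∧
      (∀ s, 0 < s → s < t → ∀ c : Fin n, (R.faceStep^[s] d).fst ≠ Sum.inl c) ∧
      R.FaceWalk (R.faceStep^[t] d) e l := by
  induction h with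
  | refl => intro b l h; cases h
  | leaf ha hw _ =>
    rintro b l ⟨⟩
    exact ⟨1, one_pos, ha, fun s h1 h2 => by omega, hw⟩
  | @node d e j w hj hw ih =>
    intro b l h
    obtain ⟨t, ht, h1, h2, h3⟩ := ih b l h
    refine ⟨t + 1, by omega, h1, fun s hs hs' c => ?_, h3⟩
    obtain _ | _ | s := s
    · omega
    · rw [Function.iterate_one, hj]
      simp
    · exact h2 (s + 1) (by omega) (by omega) c

theorem FaceWalk.isChain (w : List (Fin n)) : ∀ {d e : G.Dart} {a : Fin n}, d.fst = Sum.inl a →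
    R.FaceWalk d e w → List.IsChain R.NextLeaf (a :: w) := by
  induction w with
  | nil => intros; exact .singleton _
  | cons b l ih =>
    intro d e a hd h
    obtain ⟨t, ht, h1, h2, h3⟩ := h.exists_iterate b l rfl
    exact .cons_cons ⟨d, t, hd, ht, h1, h2⟩ (ih h1 h3)

theorem NextLeaf.unique (hA : ∀ a : Fin n, (G.neighborSet (Sum.inl a)).ncard = 1) {a b c : Fin n}
    (hb : R.NextLeaf a b) (hc : R.NextLeaf a c) : b = c := by
  obtain ⟨d, t, hd, ht, h1, h2⟩ := hb
  obtain ⟨d', t', hd', ht', h1', h2'⟩ := hc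
  obtain rfl := dart_unique (hA a) hd hd'
  rcases lt_trichotomy t t' with h | rfl | h
  · exact absurd h1 (h2' t ht h b)
  · exact Sum.inl_injective (h1.symm.trans h1')
  · exact absurd h1' (h2 t' ht' h c)

theorem Unfolds.isChain (hA : ∀ a : Fin n, (G.neighborSet (Sum.inl a)).ncard = 1)
    (hI : ∀ j : Fin k, (G.neighborSet (Sum.inr j)).ncard = 3) {d : G.Dart}
    {t : PlaneTree (Fin n) (Fin k)} (h : R.Unfolds d t) {a : Fin n} (hd : d.fst = Sum.inl a) :
    List.IsChain R.NextLeaf (a :: (t.word ++ [a])) := by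
  refine FaceWalk.isChain (e := d) _ hd ((h.faceWalk hA hI).trans ?_)
  have h1 : R.faceStep d.symm = d := by
    rw [faceStep, SimpleGraph.Dart.symm_symm]
    exact rot_eq_self (hA a) hd
  refine .leaf ?_ ?_ <;> rw [h1]
  · exact hd
  · exact .refl _

-- The next leaf is unique, so a chain of next leaves starting at `α c` must follow `α` position by
-- position. Returning to `α c` only at its end, it makes exactly one turn.
open Fin.NatCast Fin.CommRing in
theorem ofFn_eq_of_isChain [NeZero n] (hA : ∀ a : Fin n, (G.neighborSet (Sum.inl a)).ncard = 1)
    {α : Equiv.Perm (Fin n)} (hα : ∀ i : Fin n, R.NextLeaf (α i) (α (finRotate n i)))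
    {w : List (Fin n)} (c : Fin n) (hw : List.IsChain R.NextLeaf (α c :: (w ++ [α c])))
    (hc : ∀ a ∈ w, a ≠ α c) : List.ofFn (fun i => α (c + i)) = α c :: w := by
  have hlen : (α c :: (w ++ [α c])).length = w.length + 2 := by simp
  have key : ∀ (m : ℕ) (hm : m < (α c :: (w ++ [α c])).length),
      (α c :: (w ++ [α c]))[m] = α (c + (m : Fin n)) := by
    intro m
    induction m with
    | zero => intro; simp
    | succ m ih =>
      intro hm
      have h1 := hα (c + (m : Fin n))
      rw [← ih (by omega)] at h1
      have h2 := List.isChain_iff_getElem.1 hw m hm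
      rw [h2.unique hA h1, finRotate_apply]
      congr 1
      push_cast
      ring
  have hz : ∀ m : ℕ, α (c + (m : Fin n)) = α c ↔ n ∣ m := by
    intro m
    rw [α.injective.eq_iff, add_eq_left, Fin.natCast_eq_zero]
  -- The chain returns, so its length is a multiple of `n`; avoidance of `α c` inside `w` then
  -- excludes more than one turn.
  have hend : n ∣ w.length + 1 := by
    rw [← hz, ← key (w.length + 1) (by omega)]
    simp
  have hlt : w.length < n := by
    by_contra hcon
    have hn : 0 < n := NeZero.pos n
    have h1 := (hz n).2 dvd_rfl
    rw [← key n (by omega)] at h1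
    refine hc _ ?_ h1
    obtain ⟨m, hm⟩ : ∃ m, n = m + 1 := ⟨n - 1, by omega⟩
    simp only [hm, List.getElem_cons_succ]
    rw [List.getElem_append_left (by omega)]
    exact List.getElem_mem _
  have hn : w.length + 1 = n := le_antisymm hlt (Nat.le_of_dvd (by omega) hend)
  refine List.ext_getElem (by simp [hn]) fun m h1 h2 => ?_
  have h3 := key m (by rw [hlen]; rw [List.length_cons] at h2; omega)
  have h4 : (α c :: (w ++ [α c]))[m]'(by rw [hlen]; rw [List.length_cons] at h2; omega) =
    (α c :: w)[m] := List.getElem_append_left (as := α c :: w) h2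
  rw [← h4, h3, List.getElem_ofFn]
  congr 2
  rw [List.length_ofFn] at h1
  exact Fin.ext (by simp [Nat.mod_eq_of_lt h1])

end RotationSystem

/-- Root the tree at the common leaf, unfold both embeddings along its only edge, and read the two
words from the boundary tours. -/
theorem LabelledBinaryTree.IsPlanarFor.separablePair {n : ℕ} [NeZero n] {T : LabelledBinaryTree n}
    {α β : Equiv.Perm (Fin n)} (hα : T.IsPlanarFor α) (hβ : T.IsPlanarFor β) {c c' : Fin n}
    (hc : α c = β c') : ∃ w w', List.ofFn (fun i => α (c + i)) = α c :: w ∧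
      List.ofFn (fun i => β (c' + i)) = α c :: w' ∧ SeparablePair w w' := by
  obtain ⟨R₁, h₁⟩ := hα
  obtain ⟨R₂, h₂⟩ := hβ
  obtain ⟨hT, hA, hI⟩ := T.2
  obtain ⟨u, hu⟩ := Set.ncard_eq_one.1 (hA (α c))
  have hadj : T.1.Adj (Sum.inl (α c)) u := by
    have : u ∈ T.1.neighborSet (Sum.inl (α c)) := by rw [hu]; rfl
    exact this
  obtain ⟨t₁, t₂, u₁, u₂, hs, hmem⟩ := RotationSystem.exists_unfolds hT hI R₁ R₂ (Sum.inl (α c)) _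
    ⟨(_, u), hadj⟩ (by simpa using hadj) rfl
  refine ⟨t₁.word, t₂.word, ?_, ?_, hs⟩
  · exact RotationSystem.ofFn_eq_of_isChain hA h₁ c (u₁.isChain hA hI rfl)
      fun a ha h => hmem a ha (by rw [h])
  · have h := u₂.isChain hA hI (a := α c) rfl
    rw [hc] at h ⊢
    refine RotationSystem.ofFn_eq_of_isChain hA h₂ c' h fun a ha h => hmem a (hs.perm.subset ha) ?_
    rw [h, hc]

end LeafOrder

/-! ### The graph of a planted plane tree -/

namespace PlaneTree

variable {A I : Type}

/-- The root vertex of a plane tree. -/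
def vert : PlaneTree A I → A ⊕ I
  | leaf a => Sum.inl a
  | node j _ _ => Sum.inr j

/-- All vertices of a plane tree. -/
def verts : PlaneTree A I → List (A ⊕ I)
  | leaf a => [Sum.inl a]
  | node j l r => Sum.inr j :: (l.verts ++ r.verts)

/-- The internal vertices of a plane tree. -/
def nodes : PlaneTree A I → List I
  | leaf _ => []
  | node j l r => j :: (l.nodes ++ r.nodes)

/-- Planting the tree `t` on the vertex `p`, the subtree `s` of `t` is attached to the vertex
`q`. -/
inductive IsSub (p : A ⊕ I) (t : PlaneTree A I) : A ⊕ I → PlaneTree A I → Prop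
  | root : IsSub p t p t
  | left {q : A ⊕ I} {j : I} {l r : PlaneTree A I} :
      IsSub p t q (node j l r) → IsSub p t (Sum.inr j) l
  | right {q : A ⊕ I} {j : I} {l r : PlaneTree A I} :
      IsSub p t q (node j l r) → IsSub p t (Sum.inr j) r

theorem vert_mem_verts (t : PlaneTree A I) : t.vert ∈ t.verts := by
  cases t <;> simp [vert, verts]

theorem isSub_leaf {p q : A ⊕ I} {a : A} {s : PlaneTree A I} :
    IsSub p (leaf a) q s ↔ q = p ∧ s = leaf a := by
  constructor
  · intro h
    induction h with
    | root => exact ⟨rfl, rfl⟩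
    | left _ ih => cases ih.2
    | right _ ih => cases ih.2
  · rintro ⟨rfl, rfl⟩
    exact .root

theorem isSub_node {p q : A ⊕ I} {j : I} {l r s : PlaneTree A I} :
    IsSub p (node j l r) q s ↔ (q = p ∧ s = node j l r) ∨ IsSub (Sum.inr j) l q s ∨
      IsSub (Sum.inr j) r q s := by
  constructor
  · intro h
    induction h with
    | root => exact .inl ⟨rfl, rfl⟩
    | left _ ih =>
      rcases ih with ⟨rfl, h⟩ | h | h
      · cases h; exact .inr (.inl .root)
      · exact .inr (.inl h.left)
      · exact .inr (.inr h.left)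
    | right _ ih =>
      rcases ih with ⟨rfl, h⟩ | h | h
      · cases h; exact .inr (.inr .root)
      · exact .inr (.inl h.right)
      · exact .inr (.inr h.right)
  · rintro (⟨rfl, rfl⟩ | h | h)
    · exact .root
    · induction h with
      | root => exact .left .root
      | left _ ih => exact ih.left
      | right _ ih => exact ih.right
    · induction h with
      | root => exact .right .root
      | left _ ih => exact ih.left
      | right _ ih => exact ih.right

theorem IsSub.subset {p q : A ⊕ I} {t s : PlaneTree A I} (h : IsSub p t q s) :
    s.verts ⊆ t.verts := by
  induction h with
  | root => exact fun _ h => h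
  | left _ ih => exact fun _ h => ih (by simp [verts, h])
  | right _ ih => exact fun _ h => ih (by simp [verts, h])

theorem IsSub.parent_eq_or {p q : A ⊕ I} {t s : PlaneTree A I} (h : IsSub p t q s) :
    q = p ∧ s = t ∨ ∃ q' j l r, q = Sum.inr j ∧ IsSub p t q' (node j l r) ∧ (s = l ∨ s = r) := by
  cases h with
  | root => exact .inl ⟨rfl, rfl⟩
  | left h => exact .inr ⟨_, _, _, _, rfl, h, .inl rfl⟩
  | right h => exact .inr ⟨_, _, _, _, rfl, h, .inr rfl⟩

theorem nodup_node {p : A ⊕ I} {j : I} {l r : PlaneTree A I}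
    (h : (p :: (node j l r).verts).Nodup) : (Sum.inr j :: l.verts).Nodup ∧
      (Sum.inr j :: r.verts).Nodup ∧ l.verts.Disjoint r.verts := by
  simp only [verts, List.nodup_cons, List.nodup_append', List.mem_append, not_or] at h ⊢
  tauto

theorem IsSub.nodup {p q : A ⊕ I} {t s : PlaneTree A I} (h : IsSub p t q s)
    (ht : (p :: t.verts).Nodup) : (q :: s.verts).Nodup := by
  induction h with
  | root => exact ht
  | left _ ih => exact (nodup_node ih).1
  | right _ ih => exact (nodup_node ih).2.1

/-- With distinct vertices, a vertex occurs once in the plane tree and so determines its parent and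
the subtree below it. -/
theorem IsSub.unique {t : PlaneTree A I} : ∀ {p q q' : A ⊕ I} {s s' : PlaneTree A I},
    (p :: t.verts).Nodup → IsSub p t q s → IsSub p t q' s' → s.vert = s'.vert →
    q = q' ∧ s = s' := by
  induction t with
  | leaf a =>
    intro p q q' s s' _ h h' _
    rw [isSub_leaf] at h h'
    exact ⟨h.1.trans h'.1.symm, h.2.trans h'.2.symm⟩
  | node j l r ihl ihr =>
    intro p q q' s s' ht h h' hv
    obtain ⟨hl, hr, hd⟩ := nodup_node ht
    have hjl := (List.nodup_cons.1 hl).1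
    have hjr := (List.nodup_cons.1 hr).1
    rw [isSub_node] at h h'
    rcases h with ⟨rfl, rfl⟩ | h | h <;> rcases h' with ⟨rfl, rfl⟩ | h' | h'
    · exact ⟨rfl, rfl⟩
    · exact absurd (h'.subset ((show Sum.inr j = s'.vert from hv) ▸ s'.vert_mem_verts)) hjl
    · exact absurd (h'.subset ((show Sum.inr j = s'.vert from hv) ▸ s'.vert_mem_verts)) hjr
    · exact absurd (h.subset ((show s.vert = Sum.inr j from hv) ▸ s.vert_mem_verts)) hjl
    · exact ihl hl h h' hv
    · exact (hd (h.subset s.vert_mem_verts) (h'.subset (hv ▸ s'.vert_mem_verts))).elim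
    · exact absurd (h.subset ((show s.vert = Sum.inr j from hv) ▸ s.vert_mem_verts)) hjr
    · exact (hd (h'.subset s'.vert_mem_verts) (h.subset (hv ▸ s.vert_mem_verts))).elim
    · exact ihr hr h h' hv

theorem exists_isSub_of_mem {t : PlaneTree A I} : ∀ {p v : A ⊕ I}, v ∈ t.verts →
    ∃ q s, IsSub p t q s ∧ s.vert = v := by
  induction t with
  | leaf a =>
    intro p v hv
    exact ⟨p, _, .root, (List.mem_singleton.1 hv).symm⟩
  | node j l r ihl ihr =>
    intro p v hv
    rcases List.mem_cons.1 hv with rfl | hv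
    · exact ⟨p, _, .root, rfl⟩
    rcases List.mem_append.1 hv with hv | hv
    · obtain ⟨q, s, h, h'⟩ := ihl hv
      exact ⟨q, s, isSub_node.2 (.inr (.inl h)), h'⟩
    · obtain ⟨q, s, h, h'⟩ := ihr hv
      exact ⟨q, s, isSub_node.2 (.inr (.inr h)), h'⟩

theorem eq_leaf_of_vert {s : PlaneTree A I} {a : A} (h : s.vert = Sum.inl a) : s = leaf a := by
  cases s <;> simp_all [vert]

theorem exists_eq_node_of_vert {s : PlaneTree A I} {j : I} (h : s.vert = Sum.inr j) :
    ∃ l r, s = node j l r := by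
  cases s <;> simp_all [vert]

/-- The vertex `v` is a child of the vertex `u` in the tree `t` planted on `p`. -/
def IsChild (p : A ⊕ I) (t : PlaneTree A I) (u v : A ⊕ I) : Prop :=
  ∃ s, IsSub p t u s ∧ s.vert = v

/-- The graph of the tree `t` planted on the vertex `p`. -/
def graph (p : A ⊕ I) (t : PlaneTree A I) : SimpleGraph (A ⊕ I) :=
  SimpleGraph.fromRel (IsChild p t)

section Graph

variable {p : A ⊕ I} {t : PlaneTree A I}

theorem IsSub.parent_ne {q : A ⊕ I} {s : PlaneTree A I} (ht : (p :: t.verts).Nodup)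
    (h : IsSub p t q s) : q ≠ s.vert := by
  rintro rfl
  exact (List.nodup_cons.1 (h.nodup ht)).1 s.vert_mem_verts

theorem graph_adj (ht : (p :: t.verts).Nodup) {u v : A ⊕ I} :
    (graph p t).Adj u v ↔ IsChild p t u v ∨ IsChild p t v u := by
  rw [graph, SimpleGraph.fromRel_adj, and_iff_right_iff_imp]
  rintro (⟨s, h, rfl⟩ | ⟨s, h, rfl⟩)
  · exact h.parent_ne ht
  · exact (h.parent_ne ht).symm

theorem IsSub.adj (ht : (p :: t.verts).Nodup) {q : A ⊕ I} {s : PlaneTree A I}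
    (h : IsSub p t q s) : (graph p t).Adj q s.vert :=
  (graph_adj ht).2 (.inl ⟨s, h, rfl⟩)

theorem neighborSet_root {a : A} (ht : (Sum.inl a :: t.verts).Nodup) :
    (graph (Sum.inl a) t).neighborSet (Sum.inl a) = {t.vert} := by
  ext v
  rw [SimpleGraph.mem_neighborSet, graph_adj ht, Set.mem_singleton_iff]
  constructor
  · rintro (⟨s, h, rfl⟩ | ⟨s, h, hs⟩)
    · rcases h.parent_eq_or with ⟨-, rfl⟩ | ⟨_, _, _, _, h, -⟩
      · rfl
      · cases h
    · exact absurd (h.subset (hs ▸ s.vert_mem_verts)) (List.nodup_cons.1 ht).1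
  · rintro rfl
    exact .inl ⟨t, .root, rfl⟩

theorem neighborSet_leaf (ht : (p :: t.verts).Nodup) {a : A} {q : A ⊕ I}
    (h : IsSub p t q (leaf a)) : (graph p t).neighborSet (Sum.inl a) = {q} := by
  ext v
  rw [SimpleGraph.mem_neighborSet, graph_adj ht, Set.mem_singleton_iff]
  constructor
  · rintro (⟨s, h', rfl⟩ | ⟨s, h', hs⟩)
    · rcases h'.parent_eq_or with ⟨rfl, rfl⟩ | ⟨_, _, _, _, h'', -⟩
      · exact absurd (h.subset (vert_mem_verts _)) (List.nodup_cons.1 ht).1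
      · cases h''
    · exact (h'.unique ht h hs).1
  · rintro rfl
    exact .inr ⟨_, h, rfl⟩

theorem neighborSet_node {a : A} (ht : (Sum.inl a :: t.verts).Nodup) {j : I} {q : A ⊕ I}
    {l r : PlaneTree A I} (h : IsSub (Sum.inl a) t q (node j l r)) :
    (graph (Sum.inl a) t).neighborSet (Sum.inr j) = {q, l.vert, r.vert} := by
  ext v
  rw [SimpleGraph.mem_neighborSet, graph_adj ht]
  simp only [Set.mem_insert_iff, Set.mem_singleton_iff]
  constructor
  · rintro (⟨s, h', rfl⟩ | ⟨s, h', hs⟩)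
    · rcases h'.parent_eq_or with ⟨h'', -⟩ | ⟨q', j', l', r', h1, h2, h3⟩
      · cases h''
      · cases h1
        cases (h2.unique ht h rfl).2
        rcases h3 with rfl | rfl <;> simp
    · exact .inl (h'.unique ht h hs).1
  · rintro (rfl | rfl | rfl)
    · exact .inr ⟨_, h, rfl⟩
    · exact .inl ⟨_, h.left, rfl⟩
    · exact .inl ⟨_, h.right, rfl⟩

theorem node_vert_ne {q : A ⊕ I} {j : I} {l r : PlaneTree A I} (ht : (p :: t.verts).Nodup)
    (h : IsSub p t q (node j l r)) : q ≠ l.vert ∧ q ≠ r.vert ∧ l.vert ≠ r.vert := by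
  have h1 := h.nodup ht
  have hq := (List.nodup_cons.1 h1).1
  simp only [verts, List.mem_cons, List.mem_append, not_or] at hq
  refine ⟨?_, ?_, ?_⟩
  · rintro rfl
    exact hq.2.1 l.vert_mem_verts
  · rintro rfl
    exact hq.2.2 r.vert_mem_verts
  · intro he
    exact (nodup_node h1).2.2 l.vert_mem_verts (he ▸ r.vert_mem_verts)

theorem connected_graph (ht : (p :: t.verts).Nodup) (hall : ∀ v, v ∈ p :: t.verts) :
    (graph p t).Connected := by
  have key : ∀ {q : A ⊕ I} {s : PlaneTree A I}, IsSub p t q s →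
      (graph p t).Reachable p q ∧ (graph p t).Reachable p s.vert := by
    intro q s h
    induction h with
    | root => exact ⟨.refl _, (IsSub.root.adj ht).reachable⟩
    | left h ih => exact ⟨ih.2, ih.2.trans (h.left.adj ht).reachable⟩
    | right h ih => exact ⟨ih.2, ih.2.trans (h.right.adj ht).reachable⟩
  have hp : ∀ v, (graph p t).Reachable p v := by
    intro v
    rcases List.mem_cons.1 (hall v) with rfl | hv
    · exact .refl _
    · obtain ⟨q, s, h, rfl⟩ := exists_isSub_of_mem (p := p) hv
      exact (key h).2
  have : Nonempty (A ⊕ I) := ⟨p⟩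
  exact ⟨fun u v => (hp u).symm.trans (hp v)⟩

/-- Every edge joins some vertex other than `p` to its parent, so there are fewer edges than
vertices; with connectedness this forces a tree. -/
theorem isTree_graph [Fintype A] [Fintype I] (ht : (p :: t.verts).Nodup)
    (hall : ∀ v, v ∈ p :: t.verts) : (graph p t).IsTree := by
  classical
  have hc := connected_graph ht hall
  rw [SimpleGraph.isTree_iff_connected_and_card]
  refine ⟨hc, le_antisymm ?_ hc.card_vert_le_card_edgeSet_add_one⟩
  have hpar : ∀ v : {v : A ⊕ I // v ≠ p}, ∃ q, IsChild p t q v := by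
    rintro ⟨v, hv⟩
    rcases List.mem_cons.1 (hall v) with h | h
    · exact absurd h hv
    · obtain ⟨q, s, h⟩ := exists_isSub_of_mem (p := p) h
      exact ⟨q, s, h⟩
  choose par hpar using hpar
  let f : {v : A ⊕ I // v ≠ p} → (graph p t).edgeSet := fun v =>
    ⟨s(par v, v), (graph_adj ht).2 (.inl (hpar v))⟩
  have hchild : ∀ {u v}, IsChild p t u v → ∃ x, (f x : Sym2 (A ⊕ I)) = s(u, v) := by
    rintro u v ⟨s, h, rfl⟩
    have hne : s.vert ≠ p := by
      intro h'
      exact (List.nodup_cons.1 ht).1 (h.subset (h' ▸ s.vert_mem_verts))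
    refine ⟨⟨_, hne⟩, ?_⟩
    obtain ⟨s', h', hs'⟩ := hpar ⟨_, hne⟩
    show s(par ⟨_, hne⟩, s.vert) = _
    rw [(h'.unique ht h hs').1]
  have hf : Function.Surjective f := by
    rintro ⟨e, he⟩
    induction e using Sym2.ind with
    | _ u v =>
      rcases (graph_adj ht).1 he with h | h
      · obtain ⟨x, hx⟩ := hchild h
        exact ⟨x, Subtype.ext hx⟩
      · obtain ⟨x, hx⟩ := hchild h
        exact ⟨x, Subtype.ext (hx.trans Sym2.eq_swap)⟩
  have h1 := Nat.card_le_card_of_surjective f hf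
  have h2 : Nat.card {v : A ⊕ I // v ≠ p} = Nat.card (A ⊕ I) - 1 := by
    simp only [Nat.card_eq_fintype_card, Fintype.card_subtype_compl, Fintype.card_unique]
  have h3 : 0 < Nat.card (A ⊕ I) := by
    have : Nonempty (A ⊕ I) := ⟨p⟩
    exact Nat.card_pos
  omega

end Graph

end PlaneTree

/-! ### The embedding carried by a plane tree -/

namespace PlaneTree

section Rotation

variable {A I : Type} {a : A} {t : PlaneTree A I}

open Classical in
/-- The neighbour that follows the neighbour `u` of `v` in the cyclic order around `v`. -/
noncomputable def next (p : A ⊕ I) (t : PlaneTree A I) (v u : A ⊕ I) : A ⊕ I :=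
  if h : ∃ x : (A ⊕ I) × I × PlaneTree A I × PlaneTree A I,
      v = Sum.inr x.2.1 ∧ IsSub p t x.1 (node x.2.1 x.2.2.1 x.2.2.2) then
    if u = h.choose.1 then h.choose.2.2.1.vert
    else if u = h.choose.2.2.1.vert then h.choose.2.2.2.vert
    else h.choose.1
  else u

theorem next_inl (p : A ⊕ I) (t : PlaneTree A I) (b : A) (u : A ⊕ I) :
    next p t (Sum.inl b) u = u := by
  rw [next, dif_neg]
  rintro ⟨x, h, -⟩
  cases h

/-- The choice inside `next` is harmless, as `IsSub.unique` determines parent and branches. The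
cycle is parent, left branch, right branch. -/
theorem next_inr {p : A ⊕ I} (ht : (p :: t.verts).Nodup) {q : A ⊕ I} {j : I}
    {l r : PlaneTree A I} (h : IsSub p t q (node j l r)) :
    next p t (Sum.inr j) q = l.vert ∧ next p t (Sum.inr j) l.vert = r.vert ∧
      next p t (Sum.inr j) r.vert = q := by
  obtain ⟨h1, h2, h3⟩ := node_vert_ne ht h
  have hex : ∃ x : (A ⊕ I) × I × PlaneTree A I × PlaneTree A I,
      Sum.inr j = (Sum.inr x.2.1 : A ⊕ I) ∧ IsSub p t x.1 (node x.2.1 x.2.2.1 x.2.2.2) :=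
    ⟨(q, j, l, r), rfl, h⟩
  obtain ⟨e1, e2⟩ := hex.choose_spec
  have e3 : hex.choose.2.1 = j := (Sum.inr_injective e1).symm
  rw [e3] at e2
  obtain ⟨e4, e5⟩ := h.unique ht e2 rfl
  cases e5
  refine ⟨?_, ?_, ?_⟩
  · rw [next, dif_pos hex, if_pos e4]
  · rw [next, dif_pos hex, ← e4, if_neg h1.symm, if_pos rfl]
  · rw [next, dif_pos hex, ← e4, if_neg h2.symm, if_neg h3.symm]

/-- A property of neighbours in the graph of a planted plane tree can be checked at the leaves and
at the three neighbours of every internal vertex. -/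
theorem adj_cases (ht : (Sum.inl a :: t.verts).Nodup) {P : A ⊕ I → A ⊕ I → Prop}
    (hleaf : ∀ b u, (graph (Sum.inl a) t).Adj (Sum.inl b) u → P (Sum.inl b) u)
    (hnode : ∀ q j l r, IsSub (Sum.inl a) t q (node j l r) →
      P (Sum.inr j) q ∧ P (Sum.inr j) l.vert ∧ P (Sum.inr j) r.vert) {v u : A ⊕ I}
    (h : (graph (Sum.inl a) t).Adj v u) : P v u := by
  cases v with
  | inl b => exact hleaf b u h
  | inr j =>
    have : ∃ q l r, IsSub (Sum.inl a) t q (node j l r) := by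
      rcases (graph_adj ht).1 h with ⟨s, hs, -⟩ | ⟨s, hs, hj⟩
      · rcases hs.parent_eq_or with ⟨h', -⟩ | ⟨q, _, l, r, h0, h', -⟩
        · cases h'
        · cases h0
          exact ⟨q, l, r, h'⟩
      · obtain ⟨l, r, rfl⟩ := exists_eq_node_of_vert hj
        cases hj
        exact ⟨_, l, r, hs⟩
    obtain ⟨q, l, r, hs⟩ := this
    have hu : u ∈ (graph (Sum.inl a) t).neighborSet (Sum.inr j) := h
    rw [neighborSet_node ht hs] at hu
    obtain ⟨h1, h2, h3⟩ := hnode q j l r hs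
    rcases hu with rfl | rfl | rfl
    exacts [h1, h2, h3]

theorem adj_next (ht : (Sum.inl a :: t.verts).Nodup) {v u : A ⊕ I}
    (h : (graph (Sum.inl a) t).Adj v u) :
    (graph (Sum.inl a) t).Adj v (next (Sum.inl a) t v u) := by
  refine adj_cases (P := fun v u => (graph (Sum.inl a) t).Adj v (next (Sum.inl a) t v u)) ht ?_ ?_ h
  · intro b u h
    rwa [next_inl]
  · intro q j l r hs
    obtain ⟨h1, h2, h3⟩ := next_inr ht hs
    rw [h1, h2, h3]
    exact ⟨hs.left.adj ht, hs.right.adj ht, (hs.adj ht).symm⟩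

theorem next_next_next (ht : (Sum.inl a :: t.verts).Nodup) {v u : A ⊕ I}
    (h : (graph (Sum.inl a) t).Adj v u) : next (Sum.inl a) t v
      (next (Sum.inl a) t v (next (Sum.inl a) t v u)) = u := by
  refine adj_cases (P := fun v u => next (Sum.inl a) t v
      (next (Sum.inl a) t v (next (Sum.inl a) t v u)) = u) ht ?_ ?_ h
  · intro b u h
    simp only [next_inl]
  · intro q j l r hs
    obtain ⟨h1, h2, h3⟩ := next_inr ht hs
    simp only [h1, h2, h3, and_self]

/-- The dart that follows a given dart in the cyclic order around its start. -/
noncomputable def nextDart (ht : (Sum.inl a :: t.verts).Nodup) (d : (graph (Sum.inl a) t).Dart) :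
    (graph (Sum.inl a) t).Dart :=
  ⟨(d.fst, next (Sum.inl a) t d.fst d.snd), adj_next ht d.adj⟩

theorem nextDart_nextDart_nextDart (ht : (Sum.inl a :: t.verts).Nodup)
    (d : (graph (Sum.inl a) t).Dart) : nextDart ht (nextDart ht (nextDart ht d)) = d :=
  SimpleGraph.Dart.ext _ _ (Prod.ext rfl (next_next_next ht d.adj))

/-- The planar embedding of the graph of a planted plane tree. -/
noncomputable def rotationSystem (ht : (Sum.inl a :: t.verts).Nodup)
    (hleaf : ∀ b : A, ((graph (Sum.inl a) t).neighborSet (Sum.inl b)).ncard = 1) :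
    RotationSystem (graph (Sum.inl a) t) where
  rot :=
    { toFun := nextDart ht
      -- The cube of the rotation is the identity at internal vertices and at leaves alike, so its
      -- square is the inverse.
      invFun := fun d => nextDart ht (nextDart ht d)
      left_inv := nextDart_nextDart_nextDart ht
      right_inv := nextDart_nextDart_nextDart ht }
  fst_rot _ := rfl
  cyclic := by
    intro d e hde
    set f : Equiv.Perm (graph (Sum.inl a) t).Dart :=
      { toFun := nextDart ht
        invFun := fun d => nextDart ht (nextDart ht d)
        left_inv := nextDart_nextDart_nextDart ht
        right_inv := nextDart_nextDart_nextDart ht }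
    have key : ∀ {v u}, (graph (Sum.inl a) t).Adj v u →
        ∀ d e : (graph (Sum.inl a) t).Dart, d.fst = v → d.snd = u → e.fst = v → f.SameCycle d e := by
      intro v u h
      refine adj_cases (P := fun v u => ∀ d e : (graph (Sum.inl a) t).Dart, d.fst = v →
        d.snd = u → e.fst = v → f.SameCycle d e) ht ?_ ?_ h
      · intro b u _ d e hd _ he
        rw [RotationSystem.dart_unique (hleaf b) hd he]
      · intro q j l r hs
        obtain ⟨h1, h2, h3⟩ := next_inr ht hs
        let dq : (graph (Sum.inl a) t).Dart := ⟨(Sum.inr j, q), (hs.adj ht).symm⟩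
        have hall : ∀ e : (graph (Sum.inl a) t).Dart, e.fst = Sum.inr j → f.SameCycle dq e := by
          rintro ⟨⟨v, u⟩, hvu⟩ he
          obtain rfl : v = Sum.inr j := he
          have hu : u ∈ (graph (Sum.inl a) t).neighborSet (Sum.inr j) := hvu
          rw [neighborSet_node ht hs] at hu
          rcases hu with rfl | rfl | rfl
          · exact .refl _ _
          · refine ⟨1, SimpleGraph.Dart.ext _ _ (Prod.ext rfl ?_)⟩
            exact h1
          · refine ⟨2, SimpleGraph.Dart.ext _ _ (Prod.ext rfl ?_)⟩
            show next _ _ _ (next _ _ _ _) = _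
            exact (congrArg _ h1).trans h2
        refine ⟨?_, ?_, ?_⟩ <;> exact fun d e hd _ he => (hall d hd).symm.trans (hall e he)
    exact key d.adj d e rfl rfl hde.symm

theorem rotationSystem_unfolds (ht : (Sum.inl a :: t.verts).Nodup)
    (hleaf : ∀ b : A, ((graph (Sum.inl a) t).neighborSet (Sum.inl b)).ncard = 1)
    (s : PlaneTree A I) : ∀ (q : A ⊕ I) (h : IsSub (Sum.inl a) t q s),
      (rotationSystem ht hleaf).Unfolds ⟨(q, s.vert), h.adj ht⟩ s := by
  induction s with
  | leaf b => exact fun q h => .leaf rfl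
  | node j l r ihl ihr =>
    intro q h
    obtain ⟨h1, h2, h3⟩ := next_inr ht h
    refine .node (j := j) rfl ?_ ?_
    · convert ihl _ h.left using 1
      exact SimpleGraph.Dart.ext _ _ (Prod.ext rfl h1)
    · convert ihr _ h.right using 1
      refine SimpleGraph.Dart.ext _ _ (Prod.ext rfl ?_)
      show next _ _ _ (next _ _ _ _) = _
      exact (congrArg _ h1).trans h2

end Rotation

/-! ### Flips: two plane trees with one graph -/

section Flip

variable {A I : Type}

/-- Two plane trees differ by exchanging the two branches at some internal vertices. -/
inductive Flip : PlaneTree A I → PlaneTree A I → Prop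
  | leaf (a : A) : Flip (leaf a) (leaf a)
  | plus (j : I) {l l' r r' : PlaneTree A I} : Flip l l' → Flip r r' →
      Flip (node j l r) (node j l' r')
  | minus (j : I) {l l' r r' : PlaneTree A I} : Flip l l' → Flip r r' →
      Flip (node j l r) (node j r' l')

theorem Flip.perm_verts {t t' : PlaneTree A I} (h : Flip t t') : t'.verts.Perm t.verts := by
  induction h with
  | leaf => exact .refl _
  | plus j _ _ ih₁ ih₂ => exact (ih₁.append ih₂).cons _
  | minus j _ _ ih₁ ih₂ => exact (List.perm_append_comm.trans (ih₁.append ih₂)).cons _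

theorem isChild_node {p u v : A ⊕ I} {j : I} {l r : PlaneTree A I} :
    IsChild p (node j l r) u v ↔ (u = p ∧ v = Sum.inr j) ∨ IsChild (Sum.inr j) l u v ∨
      IsChild (Sum.inr j) r u v := by
  simp only [IsChild, isSub_node]
  constructor
  · rintro ⟨s, ⟨rfl, rfl⟩ | h | h, rfl⟩
    · exact .inl ⟨rfl, rfl⟩
    · exact .inr (.inl ⟨s, h, rfl⟩)
    · exact .inr (.inr ⟨s, h, rfl⟩)
  · rintro (⟨rfl, rfl⟩ | ⟨s, h, rfl⟩ | ⟨s, h, rfl⟩)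
    · exact ⟨_, .inl ⟨rfl, rfl⟩, rfl⟩
    · exact ⟨s, .inr (.inl h), rfl⟩
    · exact ⟨s, .inr (.inr h), rfl⟩

theorem Flip.isChild_iff {t t' : PlaneTree A I} (h : Flip t t') :
    ∀ {p u v : A ⊕ I}, IsChild p t u v ↔ IsChild p t' u v := by
  induction h with
  | leaf => exact Iff.rfl
  | plus j _ _ ih₁ ih₂ =>
    intro p u v
    rw [isChild_node, isChild_node, ih₁, ih₂]
  | minus j _ _ ih₁ ih₂ =>
    intro p u v
    rw [isChild_node, isChild_node, ih₁, ih₂]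
    tauto

/-- The parent-child relation does not see the order of the branches. -/
theorem Flip.graph_eq {t t' : PlaneTree A I} (h : Flip t t') (p : A ⊕ I) :
    graph p t = graph p t' := by
  unfold graph
  congr 1
  ext u v
  exact h.isChild_iff

theorem perm_verts (t : PlaneTree A I) :
    t.verts.Perm (t.word.map Sum.inl ++ t.nodes.map Sum.inr) := by
  induction t with
  | leaf => exact .refl _
  | node j l r ihl ihr =>
    rw [← Multiset.coe_eq_coe] at *
    simp only [verts, word, nodes, List.map_append, List.map_cons, ← Multiset.coe_add,
      ← Multiset.cons_coe, ← Multiset.singleton_add] at *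
    rw [ihl, ihr]
    abel

/-- Each proper join of blocks becomes an internal vertex, while joins with an empty block create
none. The names `ns` of the internal vertices are prescribed so that every vertex of the ambient
type can be used exactly once. -/
theorem exists_flip {w w' : List A} (h : SeparablePair w w') : ∀ ns : List I,
    ns.length + 1 = w.length → ∃ t t' : PlaneTree A I, Flip t t' ∧ t.word = w ∧ t'.word = w' ∧
      t.nodes = ns := by
  induction h with
  | nil => intro ns h; simp at h
  | single a =>
    intro ns h
    obtain rfl : ns = [] := by simpa using h
    exact ⟨_, _, .leaf a, rfl, rfl, rfl⟩
  | @plus u u' v v' hu hv ih₁ ih₂ =>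
    intro ns h
    have hu' := hu.length_eq
    have hv' := hv.length_eq
    rw [List.length_append] at h
    obtain _ | ⟨x, u⟩ := u
    · obtain rfl : u' = [] := by simpa using hu'
      exact ih₂ ns (by simpa using h)
    obtain _ | ⟨y, v⟩ := v
    · obtain rfl : v' = [] := by simpa using hv'
      obtain ⟨t, t', h1, h2, h3, h4⟩ := ih₁ ns (by simpa using h)
      exact ⟨t, t', h1, by simpa using h2, by simpa using h3, h4⟩
    obtain _ | ⟨j, ns⟩ := ns
    · simp at h; omega
    simp only [List.length_cons] at h ih₁ ih₂
    -- Here `u` is the tail of the original block, so its length is the number of internal vertices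
    -- of the left branch.
    obtain ⟨l, l', a1, a2, a3, a4⟩ := ih₁ (ns.take u.length) (by rw [List.length_take]; omega)
    obtain ⟨r, r', b1, b2, b3, b4⟩ := ih₂ (ns.drop u.length) (by rw [List.length_drop]; omega)
    exact ⟨.node j l r, .node j l' r', .plus j a1 b1, by rw [word, a2, b2], by rw [word, a3, b3],
      by rw [nodes, a4, b4, List.take_append_drop]⟩
  | @minus u u' v v' hu hv ih₁ ih₂ =>
    intro ns h
    have hu' := hu.length_eq
    have hv' := hv.length_eq
    rw [List.length_append] at h
    obtain _ | ⟨x, u⟩ := u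
    · obtain rfl : u' = [] := by simpa using hu'
      obtain ⟨t, t', h1, h2, h3, h4⟩ := ih₂ ns (by simpa using h)
      exact ⟨t, t', h1, by simpa using h2, by simpa using h3, h4⟩
    obtain _ | ⟨y, v⟩ := v
    · obtain rfl : v' = [] := by simpa using hv'
      obtain ⟨t, t', h1, h2, h3, h4⟩ := ih₁ ns (by simpa using h)
      exact ⟨t, t', h1, by simpa using h2, by simpa using h3, h4⟩
    obtain _ | ⟨j, ns⟩ := ns
    · simp at h; omega
    simp only [List.length_cons] at h ih₁ ih₂
    obtain ⟨l, l', a1, a2, a3, a4⟩ := ih₁ (ns.take u.length) (by rw [List.length_take]; omega)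
    obtain ⟨r, r', b1, b2, b3, b4⟩ := ih₂ (ns.drop u.length) (by rw [List.length_drop]; omega)
    exact ⟨.node j l r, .node j r' l', .minus j a1 b1, by rw [word, a2, b2], by rw [word, a3, b3],
      by rw [nodes, a4, b4, List.take_append_drop]⟩

end Flip

end PlaneTree

/-! ### A tree planar for both words of a separable pair -/

section Existence

theorem RotationSystem.nextLeaf_of_isChain {n k : ℕ} {G : SimpleGraph (Fin n ⊕ Fin k)}
    {R : RotationSystem G} {a : Fin n} {w : List (Fin n)}
    (h : List.IsChain R.NextLeaf (a :: (w ++ [a]))) {α : Equiv.Perm (Fin n)}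
    (hα : List.ofFn α = a :: w) (i : Fin n) : R.NextLeaf (α i) (α (finRotate n i)) := by
  have hlen : n = w.length + 1 := by simpa using congrArg List.length hα
  have hget : ∀ (m : ℕ) (hm : m < n), α ⟨m, hm⟩ = (a :: (w ++ [a]))[m]'(by simp; omega) := by
    intro m hm
    have h1 : (List.ofFn α)[m]'(by simpa using hm) = α ⟨m, hm⟩ := by simp
    rw [← h1]
    simp only [hα]
    exact (List.getElem_append_left (as := a :: w) (by simp; omega)).symm
  have hlast : (a :: (w ++ [a]))[n]'(by simp; omega) = a := by
    simp [hlen]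
  obtain ⟨i, hi⟩ := i
  have hc := List.isChain_iff_getElem.1 h i (by simp; omega)
  rw [← hget i hi] at hc
  rcases Nat.lt_or_ge (i + 1) n with h1 | h1
  · have : finRotate n ⟨i, hi⟩ = ⟨i + 1, h1⟩ := by
      have := Fin.neZero ⟨i, hi⟩
      rw [finRotate_apply]
      ext
      rw [Fin.val_add_one_of_lt' h1]
    rw [this, hget (i + 1) h1]
    exact hc
  -- At the last position the rotation wraps around, matched by the final `a` of the chain.
  · obtain rfl : i + 1 = n := by omega
    have : finRotate (i + 1) ⟨i, hi⟩ = ⟨0, by omega⟩ := finRotate_last'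
    rw [this, hget 0 (by omega)]
    rw [hlast] at hc
    exact hc

/-- Plant the two flipped plane trees on the leaf `a`. They have the same graph, and each supplies
one of the required embeddings. -/
theorem LabelledBinaryTree.exists_isPlanarFor {n : ℕ} (hn : 2 ≤ n) {a : Fin n} {w w' : List (Fin n)}
    (hw : (a :: w).Perm (List.finRange n)) (h : SeparablePair w w') :
    ∃ T : LabelledBinaryTree n, (∀ α : Equiv.Perm (Fin n), List.ofFn α = a :: w → T.IsPlanarFor α) ∧
      ∀ α : Equiv.Perm (Fin n), List.ofFn α = a :: w' → T.IsPlanarFor α := by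
  have hlen : w.length + 1 = n := by simpa using hw.length_eq
  obtain ⟨t, t', hf, rfl, rfl, hns⟩ := PlaneTree.exists_flip h (List.finRange (n - 2))
    (by rw [List.length_finRange]; omega)
  have hverts : (Sum.inl a :: t.verts).Perm
      ((List.finRange n).map Sum.inl ++ (List.finRange (n - 2)).map Sum.inr) := by
    have h1 := t.perm_verts.cons (Sum.inl a)
    rw [hns, ← List.cons_append, ← List.map_cons] at h1
    exact h1.trans ((hw.map _).append_right _)
  have ht : (Sum.inl a :: t.verts).Nodup := by
    rw [hverts.nodup_iff, List.nodup_append']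
    refine ⟨(List.nodup_finRange n).map Sum.inl_injective,
      (List.nodup_finRange _).map Sum.inr_injective, ?_⟩
    intro x h1 h2
    obtain ⟨_, -, rfl⟩ := List.mem_map.1 h1
    obtain ⟨_, -, h3⟩ := List.mem_map.1 h2
    cases h3
  have hall : ∀ v, v ∈ Sum.inl a :: t.verts := by
    intro v
    rw [hverts.mem_iff]
    cases v <;> simp
  have ht' : (Sum.inl a :: t'.verts).Nodup := ((hf.perm_verts.cons _).nodup_iff).2 ht
  have hA : ∀ b : Fin n, ((PlaneTree.graph (Sum.inl a) t).neighborSet (Sum.inl b)).ncard = 1 := by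
    intro b
    rcases List.mem_cons.1 (hall (Sum.inl b)) with h | h
    · cases h
      rw [PlaneTree.neighborSet_root ht, Set.ncard_singleton]
    · obtain ⟨q, s, hs, hb⟩ := PlaneTree.exists_isSub_of_mem (p := Sum.inl a) h
      obtain rfl := PlaneTree.eq_leaf_of_vert hb
      rw [PlaneTree.neighborSet_leaf ht hs, Set.ncard_singleton]
  have hI : ∀ j : Fin (n - 2),
      ((PlaneTree.graph (Sum.inl a) t).neighborSet (Sum.inr j)).ncard = 3 := by
    intro j
    have h := List.mem_of_ne_of_mem Sum.inr_ne_inl (hall (Sum.inr j))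
    obtain ⟨q, s, hs, hb⟩ := PlaneTree.exists_isSub_of_mem (p := Sum.inl a) h
    obtain ⟨l, r, rfl⟩ := PlaneTree.exists_eq_node_of_vert hb
    cases hb
    obtain ⟨h1, h2, h3⟩ := PlaneTree.node_vert_ne ht hs
    rw [PlaneTree.neighborSet_node ht hs, Set.ncard_eq_three]
    exact ⟨_, _, _, h1, h2, h3, rfl⟩
  have main : ∀ (s : PlaneTree (Fin n) (Fin (n - 2))) (hs : (Sum.inl a :: s.verts).Nodup)
      (hA : ∀ b : Fin n, ((PlaneTree.graph (Sum.inl a) s).neighborSet (Sum.inl b)).ncard = 1)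
      (hI : ∀ j : Fin (n - 2), ((PlaneTree.graph (Sum.inl a) s).neighborSet (Sum.inr j)).ncard = 3)
      (α : Equiv.Perm (Fin n)), List.ofFn α = a :: s.word →
      ∃ R : RotationSystem (PlaneTree.graph (Sum.inl a) s), ∀ i, R.NextLeaf (α i) (α (finRotate n i)) := by
    intro s hs hA hI α hα
    exact ⟨PlaneTree.rotationSystem hs hA, RotationSystem.nextLeaf_of_isChain
      ((PlaneTree.rotationSystem_unfolds hs hA s _ .root).isChain hA hI rfl) hα⟩
  refine ⟨⟨_, PlaneTree.isTree_graph ht hall, hA, hI⟩, main t ht hA hI, fun α hα => ?_⟩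
  have hA' := hA
  have hI' := hI
  -- The degree conditions are moved to the flipped tree, embedded there, and the embedding is moved
  -- back along the equality of graphs.
  rw [hf.graph_eq] at hA' hI'
  have := main t' ht' hA' hI' α hα
  rw [← hf.graph_eq] at this
  exact this

end Existence

/-! ### The dihedral group acting on positions -/

section PositionSymmetries

/-- With addition modulo `n`, rotations are translations and reflections are i ↦ c - i. These maps
are closed under composition, and each is a power of the rotation, possibly times the reversal. -/
theorem mem_positionSymmetries {n : ℕ} [NeZero n] {σ : Equiv.Perm (Fin n)} :
    σ ∈ positionSymmetries n ↔ (∃ c, ∀ i, σ i = c + i) ∨ ∃ c, ∀ i, σ i = c - i := by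
  obtain ⟨k, rfl⟩ : ∃ k, n = k + 1 := ⟨n - 1, by have := NeZero.pos n; omega⟩
  have hrev : ∀ i : Fin (k + 1), Fin.revPerm i = Fin.last k - i := fun i => (Fin.last_sub i).symm
  constructor
  · intro h
    induction h using Subgroup.closure_induction with
    | mem x hx =>
      rcases hx with rfl | rfl
      · exact .inl ⟨1, fun i => by rw [finRotate_apply]; exact add_comm _ _⟩
      · exact .inr ⟨_, hrev⟩
    | one => exact .inl ⟨0, fun i => by simp⟩
    | mul x y _ _ hx hy =>
      rcases hx with ⟨c, hx⟩ | ⟨c, hx⟩ <;> rcases hy with ⟨d, hy⟩ | ⟨d, hy⟩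
      · exact .inl ⟨c + d, fun i => by rw [Equiv.Perm.mul_apply, hy, hx]; abel⟩
      · exact .inr ⟨c + d, fun i => by rw [Equiv.Perm.mul_apply, hy, hx]; abel⟩
      · exact .inr ⟨c - d, fun i => by rw [Equiv.Perm.mul_apply, hy, hx]; abel⟩
      · exact .inl ⟨c - d, fun i => by rw [Equiv.Perm.mul_apply, hy, hx]; abel⟩
    | inv x _ hx =>
      rcases hx with ⟨c, hx⟩ | ⟨c, hx⟩
      · exact .inl ⟨-c, fun i => by rw [Equiv.Perm.inv_eq_iff_eq, hx]; abel⟩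
      · exact .inr ⟨c, fun i => by rw [Equiv.Perm.inv_eq_iff_eq, hx]; abel⟩
  · have hrot : ∀ (m : ℕ) (i : Fin (k + 1)),
        (finRotate (k + 1) ^ m) i = Fin.ofNat (k + 1) m + i := by
      intro m
      induction m with
      | zero => intro i; simp
      | succ m ih =>
        intro i
        rw [pow_succ', Equiv.Perm.mul_apply, ih, finRotate_apply]
        ext
        simp [Fin.val_add, add_assoc, add_comm, add_left_comm]
    have htr : ∀ c : Fin (k + 1), ∀ τ : Equiv.Perm (Fin (k + 1)), (∀ i, τ i = c + i) →
        τ ∈ positionSymmetries (k + 1) := by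
      intro c τ hτ
      have : τ = finRotate (k + 1) ^ (c : ℕ) := by
        ext i
        rw [hτ, hrot, Fin.ofNat_val_eq_self]
      rw [this]
      exact pow_mem (Subgroup.subset_closure (by simp)) _
    rintro (⟨c, h⟩ | ⟨c, h⟩)
    · exact htr c σ h
    · have h1 : σ * Fin.revPerm ∈ positionSymmetries (k + 1) := by
        refine htr (c - Fin.last k) _ fun i => ?_
        rw [Equiv.Perm.mul_apply, h, hrev]
        abel
      exact (Subgroup.mul_mem_cancel_right _ (Subgroup.subset_closure (by simp))).1 h1

theorem mk_mul_eq {n : ℕ} (α : Equiv.Perm (Fin n)) {σ : Equiv.Perm (Fin n)}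
    (h : σ ∈ positionSymmetries n) :
    (QuotientGroup.mk (α * σ) : CircularOrdering n) = QuotientGroup.mk α :=
  QuotientGroup.eq.2 (by simpa using h)

theorem ofFn_neg {n : ℕ} [NeZero n] {β : Type*} {f : Fin n → β} {a : β} {w : List β}
    (h : List.ofFn f = a :: w) : List.ofFn (fun i => f (-i)) = a :: w.reverse := by
  have hlen : n = w.length + 1 := by simpa using congrArg List.length h
  have hget : ∀ (m : ℕ) (hm : m < n), f ⟨m, hm⟩ = (a :: w)[m]'(by simp; omega) := by
    intro m hm
    simp only [← h, List.getElem_ofFn]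
  refine List.ext_getElem (by simp [hlen]) fun m h1 h2 => ?_
  rw [List.getElem_ofFn]
  rw [List.length_ofFn] at h1
  obtain _ | m := m
  · have : (-(⟨0, h1⟩ : Fin n)) = ⟨0, h1⟩ := by ext; simp
    rw [this, hget]
    rfl
  · have : (-(⟨m + 1, h1⟩ : Fin n)) = ⟨n - (m + 1), by omega⟩ := by
      ext
      simp only [Fin.val_neg']
      exact Nat.mod_eq_of_lt (by omega)
    rw [this, hget, List.getElem_cons_succ, List.getElem_reverse]
    have h3 : n - (m + 1) = w.length - 1 - m + 1 := by omega
    simp only [h3, List.getElem_cons_succ]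

theorem ofFn_add {n : ℕ} [NeZero n] {β : Type*} (f : Fin n → β) (c : Fin n) :
    List.ofFn (fun i => f (c + i)) = (List.ofFn f).rotate c := by
  refine List.ext_getElem (by simp) fun m h1 h2 => ?_
  rw [List.getElem_rotate]
  simp only [List.getElem_ofFn, List.length_ofFn]
  congr 1
  ext
  simp [Fin.val_add, add_comm]

end PositionSymmetries

/-! ### Circular orderings represented by words -/

namespace CircularOrdering

variable {n : ℕ} {p q : CircularOrdering n}

theorem HasWord.perm {l : List ℕ} (h : q.HasWord l) : l.Perm (List.range' 1 n) := by
  obtain ⟨α, -, rfl⟩ := h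
  refine (List.perm_ext_iff_of_nodup (List.nodup_ofFn.2 ?_) List.nodup_range').2 fun x => ?_
  · intro i j hij
    exact α.injective (Fin.ext (by simpa using hij))
  · rw [List.mem_ofFn, List.mem_range'_1]
    constructor
    · rintro ⟨i, rfl⟩
      have := (α i).2
      omega
    · rintro ⟨h1, h2⟩
      refine ⟨α.symm ⟨x - 1, by omega⟩, ?_⟩
      simp only [Equiv.apply_symm_apply]
      omega

theorem exists_hasWord {l : List ℕ} (h : l.Perm (List.range' 1 n)) :
    ∃ q : CircularOrdering n, q.HasWord l := by
  have hlen : l.length = n := by simpa using h.length_eq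
  have hn : l.Nodup := h.nodup_iff.2 List.nodup_range'
  have hmem : ∀ x ∈ l, 1 ≤ x ∧ x < n + 1 := fun x hx => by
    have := h.subset hx
    rw [List.mem_range'_1] at this
    omega
  let f : Fin n → Fin n := fun i => ⟨l[(i : ℕ)] - 1, by
    have := hmem _ (List.getElem_mem (l := l) (n := i) (by omega))
    omega⟩
  have hf : Function.Injective f := by
    intro i j hij
    have h1 := hmem _ (List.getElem_mem (l := l) (n := i) (by omega))
    have h2 := hmem _ (List.getElem_mem (l := l) (n := j) (by omega))
    have h3 : l[(i : ℕ)] - 1 = l[(j : ℕ)] - 1 := congrArg Fin.val hij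
    exact Fin.ext ((hn.getElem_inj_iff).1 (by omega))
  refine ⟨_, Equiv.ofBijective f (Finite.injective_iff_bijective.1 hf), rfl, ?_⟩
  refine List.ext_getElem (by simp [hlen]) fun m h1 h2 => ?_
  have := hmem _ (List.getElem_mem h2)
  simp only [List.getElem_ofFn, Equiv.ofBijective_apply, f]
  omega

theorem word_injective {α β : Equiv.Perm (Fin n)}
    (h : List.ofFn (fun i => (α i : ℕ) + 1) = List.ofFn (fun i => (β i : ℕ) + 1)) : α = β := by
  ext i
  simpa using congrFun (List.ofFn_injective h) i

theorem HasWord.unique {l : List ℕ} (hp : p.HasWord l) (hq : q.HasWord l) : p = q := by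
  obtain ⟨α, rfl, h⟩ := hp
  obtain ⟨β, rfl, h'⟩ := hq
  rw [word_injective (h.trans h'.symm)]

variable [NeZero n]

theorem HasWord.append_comm {x y : List ℕ} (h : q.HasWord (x ++ y)) : q.HasWord (y ++ x) := by
  obtain ⟨α, rfl, h⟩ := h
  have hlen : n = x.length + y.length := by simpa using congrArg List.length h
  rcases List.eq_nil_or_concat y with rfl | ⟨y', b, rfl⟩
  · exact ⟨α, rfl, by simpa using h⟩
  have hx : x.length < n := by simp at hlen; omega
  refine ⟨α * Equiv.addLeft ⟨x.length, hx⟩, mk_mul_eq α (mem_positionSymmetries.2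
    (.inl ⟨⟨x.length, hx⟩, fun i => rfl⟩)), ?_⟩
  have := ofFn_add (fun i => (α i : ℕ) + 1) ⟨x.length, hx⟩
  rw [h, List.rotate_append_length_eq] at this
  exact this

theorem HasWord.reverse {a : ℕ} {l : List ℕ} (h : q.HasWord (a :: l)) :
    q.HasWord (a :: l.reverse) := by
  obtain ⟨α, rfl, h⟩ := h
  exact ⟨α * Equiv.neg _, mk_mul_eq α (mem_positionSymmetries.2
    (.inr ⟨0, fun i => by simp⟩)), ofFn_neg h⟩

/-- Fixing the first letter fixes position 0, whose stabiliser consists of the identity and i ↦ -i.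
-/
theorem HasWord.eq_or_eq_reverse {a : ℕ} {l l' : List ℕ} (h : q.HasWord (a :: l))
    (h' : q.HasWord (a :: l')) : l' = l ∨ l' = l.reverse := by
  obtain ⟨α, rfl, h⟩ := h
  obtain ⟨β, hβ, h'⟩ := h'
  have hσ := mem_positionSymmetries.1 (QuotientGroup.eq.1 hβ.symm)
  have hzero : ∀ (γ : Equiv.Perm (Fin n)) (w : List ℕ),
      List.ofFn (fun i => (γ i : ℕ) + 1) = a :: w → (γ 0 : ℕ) + 1 = a := by
    intro γ w hw
    have h1 := congrArg (fun l => l[0]?) hw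
    have hn := NeZero.pos n
    simpa [List.getElem?_ofFn, hn] using h1
  have h0 : α 0 = β 0 := Fin.ext (by have := hzero α l h; have := hzero β l' h'; omega)
  rcases hσ with ⟨c, hc⟩ | ⟨c, hc⟩
  · have hc0 : c = 0 := by
      have := hc 0
      rw [Equiv.Perm.mul_apply, ← h0, ← Equiv.Perm.mul_apply, inv_mul_cancel, Equiv.Perm.one_apply, add_zero] at this
      exact this.symm
    have : β = α := by
      ext1 i
      have := hc i
      rw [hc0, zero_add, Equiv.Perm.mul_apply, Equiv.Perm.inv_eq_iff_eq] at this
      exact this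
    rw [this, h] at h'
    exact .inl (List.cons.inj h').2.symm
  · have hc0 : c = 0 := by
      have := hc 0
      rw [Equiv.Perm.mul_apply, ← h0, ← Equiv.Perm.mul_apply, inv_mul_cancel, Equiv.Perm.one_apply, sub_zero] at this
      exact this.symm
    have hβ : ∀ i, β i = α (-i) := by
      intro i
      have := hc i
      rw [hc0, zero_sub, Equiv.Perm.mul_apply, Equiv.Perm.inv_eq_iff_eq] at this
      exact this
    have := ofFn_neg h
    simp only [← hβ] at this
    rw [h'] at this
    exact .inr (List.cons.inj this).2

theorem exists_hasWord_cons (q : CircularOrdering n) {a : ℕ} (ha : 1 ≤ a) (ha' : a ≤ n) :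
    ∃ l, q.HasWord (a :: l) := by
  obtain ⟨α, rfl⟩ := QuotientGroup.mk_surjective q
  have hw : HasWord (QuotientGroup.mk α : CircularOrdering n)
    (List.ofFn (fun i => (α i : ℕ) + 1)) := ⟨α, rfl, rfl⟩
  have hmem : a ∈ List.ofFn (fun i => (α i : ℕ) + 1) :=
    hw.perm.symm.subset (List.mem_range'_1.2 ⟨ha, by omega⟩)
  obtain ⟨x, y, h⟩ := List.append_of_mem hmem
  rw [h] at hw
  exact ⟨_, hw.append_comm⟩

end CircularOrdering

/-! ### The criterion for a nonzero entry -/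

section Transport

variable {n : ℕ}

/-- An embedding can be carried along a renaming of internal vertices. This puts the two
representatives of a common class on one and the same tree. -/
theorem LabelledBinaryTree.IsPlanarFor.of_iso {S T : LabelledBinaryTree n} {α : Equiv.Perm (Fin n)}
    (hT : T.IsPlanarFor α) (h : (labelledBinaryTreeSetoid n).r S T) : S.IsPlanarFor α := by
  obtain ⟨π, h⟩ := h
  obtain ⟨R, hR⟩ := hT
  let φ : (Fin n ⊕ Fin (n - 2)) ≃ (Fin n ⊕ Fin (n - 2)) := Equiv.sumCongr (Equiv.refl _) π
  have hφ : ∀ u v, T.1.Adj (φ u) (φ v) ↔ S.1.Adj u v := by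
    intro u v
    rw [← h]
    cases u <;> cases v <;> rfl
  let F : S.1.Dart ≃ T.1.Dart :=
    { toFun := fun d => ⟨(φ d.fst, φ d.snd), (hφ _ _).2 d.adj⟩
      invFun := fun d => ⟨(φ.symm d.fst, φ.symm d.snd), (hφ _ _).1 (by simp)⟩
      left_inv := fun d => SimpleGraph.Dart.ext _ _ (Prod.ext (by simp) (by simp))
      right_inv := fun d => SimpleGraph.Dart.ext _ _ (Prod.ext (by simp) (by simp)) }
  have hF : ∀ d, (F d).fst = φ d.fst := fun _ => rfl
  have hF' : ∀ d, (F.symm d).fst = φ.symm d.fst := fun _ => rfl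
  let R' : RotationSystem S.1 :=
    { rot := F.symm.permCongr R.rot
      fst_rot := fun d => by
        rw [Equiv.permCongr_apply, hF', R.fst_rot, Equiv.symm_symm, hF, Equiv.symm_apply_apply]
      cyclic := fun d e hde => by
        obtain ⟨i, hi⟩ := R.cyclic (F d) (F e) (by rw [hF, hF, hde])
        refine ⟨i, ?_⟩
        have : (F.symm.permCongr R.rot) ^ i = F.symm.permCongr (R.rot ^ i) :=
          (map_zpow F.symm.permCongrHom R.rot i).symm
        rw [this, Equiv.permCongr_apply, Equiv.symm_symm, hi, Equiv.symm_apply_apply] }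
  have hstep : Function.Semiconj F R'.faceStep R.faceStep := by
    intro d
    show F (F.symm (R.rot (F.symm.symm d.symm))) = R.rot (F d).symm
    rw [Equiv.apply_symm_apply]
    rfl
  have hiter : ∀ t d, (R.faceStep^[t] (F d)).fst = φ (R'.faceStep^[t] d).fst := fun t d => by
    rw [← hF, (hstep.iterate_right t) d]
  have hinl : ∀ u c, φ u = Sum.inl c ↔ u = Sum.inl c := by
    intro u c
    cases u <;> simp [φ]
  refine ⟨R', fun i => ?_⟩
  obtain ⟨d, t, hd, ht, h1, h2⟩ := hR i
  obtain ⟨d, rfl⟩ := F.surjective d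
  refine ⟨d, t, (hinl _ _).1 hd, ht, (hinl _ _).1 (by rw [← hiter, h1]), fun s hs hs' c hc => ?_⟩
  exact h2 s hs hs' c (by rw [hiter, hc, (hinl _ _).2 rfl])

instance : Finite (UnrootedBinaryTree n) := by
  have : Finite (LabelledBinaryTree n) := by
    unfold LabelledBinaryTree
    infer_instance
  exact Quotient.finite _

open CircularOrdering

/-- The bridge from trees to words. Finiteness of the set of trees matters, since `ncard` vanishes
on infinite sets. -/
theorem intersectionMatrix_ne_zero_iff (hn : 2 ≤ n) {p q : CircularOrdering n} {a : ℕ}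
    {l l' : List ℕ} (hp : p.HasWord (a :: l)) (hq : q.HasWord (a :: l')) :
    intersectionMatrix n p q ≠ 0 ↔ SeparablePair l l' := by
  have : NeZero n := ⟨by omega⟩
  unfold intersectionMatrix
  rw [← Nat.pos_iff_ne_zero, Set.ncard_pos (Set.toFinite _)]
  constructor
  · rintro ⟨_, ⟨S, α, hST, hα, hS⟩, T, β, rfl, hβ, hT⟩
    have hT' : S.IsPlanarFor β := hT.of_iso (Quotient.exact hST)
    have ha := hp.perm.subset List.mem_cons_self
    rw [List.mem_range'_1] at ha
    let b : Fin n := ⟨a - 1, by omega⟩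
    have hb : (b : ℕ) + 1 = a := by simp only [b]; omega
    obtain ⟨w, w', hw, hw', hs⟩ := hS.separablePair hT' (c := α.symm b) (c' := β.symm b) (by simp)
    rw [Equiv.apply_symm_apply] at hw hw'
    have key : ∀ (γ : Equiv.Perm (Fin n)) (c : Fin n) (w : List (Fin n)),
        List.ofFn (fun i => γ (c + i)) = b :: w →
        HasWord (QuotientGroup.mk γ : CircularOrdering n) (a :: w.map (fun i : Fin n => (i : ℕ) + 1)) := by
      intro γ c w h
      refine ⟨γ * Equiv.addLeft c, mk_mul_eq γ (mem_positionSymmetries.2 (.inl ⟨c, fun i => rfl⟩)),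
        ?_⟩
      have := congrArg (List.map (fun i : Fin n => (i : ℕ) + 1)) h
      rw [List.map_ofFn, List.map_cons, hb] at this
      exact this
    have h1 := key α _ w hw
    have h2 := key β _ w' hw'
    rw [hα] at h1
    rw [hβ] at h2
    have hs' := hs.map (fun i : Fin n => (i : ℕ) + 1)
    -- The embeddings determine each word only up to reversal, under which separability is invariant
    -- on either side.
    rcases h1.eq_or_eq_reverse hp with rfl | rfl <;> rcases h2.eq_or_eq_reverse hq with rfl | rfl
    · exact hs'
    · exact hs'.reverse_right
    · exact hs'.reverse_left
    · exact hs'.reverse_left.reverse_right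
  · intro h
    obtain ⟨α, rfl, hα⟩ := hp
    obtain ⟨β, rfl, hβ⟩ := hq
    have key : ∀ (γ : Equiv.Perm (Fin n)) (w : List ℕ), List.ofFn (fun i => (γ i : ℕ) + 1) = w →
        List.ofFn γ = w.map (fun x => Fin.ofNat n (x - 1)) := by
      rintro γ _ rfl
      rw [List.map_ofFn]
      congr 1
      ext i
      simp
    have h1 := key α _ hα
    have h2 := key β _ hβ
    rw [List.map_cons] at h1 h2
    have hperm : (List.ofFn α).Perm (List.finRange n) :=
      (List.perm_ext_iff_of_nodup (List.nodup_ofFn.2 α.injective) (List.nodup_finRange n)).2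
        fun x => by simp [List.mem_ofFn, α.surjective x]
    rw [h1] at hperm
    obtain ⟨T, hT, hT'⟩ := LabelledBinaryTree.exists_isPlanarFor hn hperm
      (h.map (fun x => Fin.ofNat n (x - 1)))
    exact ⟨Quotient.mk _ T, ⟨T, α, rfl, rfl, hT α h1⟩, T, β, rfl, rfl, hT' β h2⟩

end Transport

/-! ### Two-to-one maps and row-regular matrices -/

section Counting

theorem two_mul_ncard_image {α β : Type*} {f : α → β} {τ : α → α} {B : Set α} (hB : B.Finite)
    (hτ : ∀ x ∈ B, τ x ∈ B ∧ τ x ≠ x)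
    (hf : ∀ x ∈ B, ∀ y ∈ B, f y = f x ↔ y = x ∨ y = τ x) : 2 * (f '' B).ncard = B.ncard := by
  classical
  lift B to Finset α using hB
  rw [← Finset.coe_image, Set.ncard_coe_finset, Set.ncard_coe_finset,
    Finset.card_eq_sum_card_image f B, mul_comm, ← smul_eq_mul, ← Finset.sum_const]
  refine Finset.sum_congr rfl fun b hb => ?_
  obtain ⟨x, hx, rfl⟩ := Finset.mem_image.1 hb
  have : B.filter (fun y => f y = f x) = {x, τ x} := by
    ext y
    simp only [Finset.mem_filter, Finset.mem_insert, Finset.mem_singleton]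
    constructor
    · rintro ⟨hy, h⟩
      exact (hf x hx y hy).1 h
    · intro h
      have hy : y ∈ B := by
        rcases h with rfl | rfl
        · exact hx
        · exact (hτ x hx).1
      exact ⟨hy, (hf x hx y hy).2 h⟩
  rw [this, Finset.card_pair (hτ x hx).2.symm]

theorem List.ncard_setOf_perm {α : Type*} {w : List α} (hw : w.Nodup) :
    {l : List α | l.Perm w}.ncard = w.length.factorial := by
  classical
  have : {l : List α | l.Perm w} = (w.permutations.toFinset : Set (List α)) := by
    ext l
    simp
  rw [this, Set.ncard_coe_finset, List.toFinset_card_of_nodup (List.nodup_permutations _ hw),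
    List.length_permutations]

theorem List.Nodup.reverse_ne {α : Type*} {l : List α} (h : l.Nodup) (hl : 2 ≤ l.length) :
    l.reverse ≠ l := by
  intro he
  have h1 : l.reverse[0]'(by simp; omega) = l[0] := by simp only [he]
  rw [List.getElem_reverse, h.getElem_inj_iff] at h1
  omega

theorem matrixDensity_eq_div {R C : Type} [Finite R] [Finite C] [Nonempty R] (M : Matrix R C ℕ)
    (r : ℕ) (h : ∀ p, Nat.card {q // M p q ≠ 0} = r) : matrixDensity M = r / Nat.card C := by
  have hcard : Nat.card {x : R × C // M x.1 x.2 ≠ 0} = Nat.card R * r := by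
    have e : {x : R × C // M x.1 x.2 ≠ 0} ≃ Σ p, {q // M p q ≠ 0} :=
      { toFun := fun x => ⟨x.1.1, x.1.2, x.2⟩
        invFun := fun x => ⟨(x.1, x.2.1), x.2.2⟩
        left_inv := fun _ => rfl
        right_inv := fun _ => rfl }
    have := Fintype.ofFinite R
    rw [Nat.card_congr e, Nat.card_sigma]
    simp only [h, Finset.sum_const, smul_eq_mul, Nat.card_eq_fintype_card, Finset.card_univ]
  have hR : (Nat.card R : ℝ) ≠ 0 := by exact_mod_cast Nat.card_pos.ne'
  rw [matrixDensity, hcard, Nat.card_prod]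
  push_cast
  rw [mul_div_mul_left _ _ hR]

end Counting

/-! ### Size and row counts of the full intersection matrix -/

namespace CircularOrdering

variable {n : ℕ}

open Classical in
/-- The ordering represented by a word. -/
noncomputable def ofWord (n : ℕ) (l : List ℕ) : CircularOrdering n :=
  if h : ∃ q : CircularOrdering n, q.HasWord l then h.choose else QuotientGroup.mk 1

theorem hasWord_ofWord {l : List ℕ} (h : l.Perm (List.range' 1 n)) : (ofWord n l).HasWord l := by
  have := exists_hasWord h
  rw [ofWord, dif_pos this]
  exact this.choose_spec

theorem HasWord.eq_ofWord {q : CircularOrdering n} {l : List ℕ} (h : q.HasWord l) :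
    q = ofWord n l :=
  h.unique (hasWord_ofWord h.perm)

theorem range'_one_eq_cons (hn : 1 ≤ n) : List.range' 1 n = 1 :: List.range' 2 (n - 1) := by
  obtain ⟨k, rfl⟩ : ∃ k, n = k + 1 := ⟨n - 1, by omega⟩
  rfl

/-- Each ordering comes from a word and its reversal, which differ because at least two letters
follow the initial 1. -/
theorem two_mul_ncard_image_ofWord (hn : 3 ≤ n) {B : Set (List ℕ)}
    (hB : ∀ l ∈ B, l.Perm (List.range' 2 (n - 1))) (hr : ∀ l ∈ B, l.reverse ∈ B) :
    2 * ((fun l => ofWord n (1 :: l)) '' B).ncard = B.ncard := by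
  have : NeZero n := ⟨by omega⟩
  have hw : ∀ l ∈ B, (ofWord n (1 :: l)).HasWord (1 :: l) := by
    intro l hl
    refine hasWord_ofWord ?_
    rw [range'_one_eq_cons (by omega)]
    exact (hB l hl).cons _
  refine two_mul_ncard_image ((List.finite_setOf_perm _).subset hB) (τ := List.reverse) ?_ ?_
  · refine fun l hl => ⟨hr l hl, List.Nodup.reverse_ne ((hB l hl).nodup_iff.2 List.nodup_range') ?_⟩
    rw [(hB l hl).length_eq, List.length_range']
    omega
  · intro x hx y hy
    constructor
    · intro h
      have h1 := hw y hy
      rw [h] at h1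
      exact (hw x hx).eq_or_eq_reverse h1
    · rintro (rfl | rfl)
      · rfl
      · exact (hw _ hy).unique (hw x hx).reverse

theorem two_mul_card (hn : 3 ≤ n) : 2 * Nat.card (CircularOrdering n) = (n - 1).factorial := by
  have : NeZero n := ⟨by omega⟩
  have h := two_mul_ncard_image_ofWord hn (B := {l | l.Perm (List.range' 2 (n - 1))})
    (fun _ h => h) (fun l h => (List.reverse_perm l).trans h)
  rw [List.ncard_setOf_perm List.nodup_range', List.length_range'] at h
  rw [← h, ← Set.ncard_univ]
  congr 2
  symm
  rw [Set.eq_univ_iff_forall]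
  intro q
  obtain ⟨l, hl⟩ := q.exists_hasWord_cons (a := 1) le_rfl (by omega)
  have hp := hl.perm
  rw [range'_one_eq_cons (by omega)] at hp
  exact ⟨l, hp.cons_inv, hl.eq_ofWord.symm⟩

/-- After cutting at the label 1 there are n-1 letters, hence L_{n-2} separable words, and reversal
pairs them up. -/
theorem two_mul_card_intersectionMatrix_row (hn : 3 ≤ n) (p : CircularOrdering n) :
    2 * Nat.card {q // intersectionMatrix n p q ≠ 0} = Nat.largeSchroder (n - 2) := by
  have : NeZero n := ⟨by omega⟩
  obtain ⟨l, hl⟩ := p.exists_hasWord_cons (a := 1) le_rfl (by omega)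
  have hp := hl.perm
  rw [range'_one_eq_cons (by omega)] at hp
  have hp' := hp.cons_inv
  have h := two_mul_ncard_image_ofWord hn (B := separableWords l)
    (fun x h => (SeparablePair.perm h).trans hp') (fun x h => SeparablePair.reverse_right h)
  rw [ncard_separableWords (n - 2) l (hp'.nodup_iff.2 List.nodup_range')
    (by rw [hp'.length_eq, List.length_range']; omega)] at h
  rw [← h]
  congr 1
  change Nat.card {q | intersectionMatrix n p q ≠ 0} = _
  rw [Nat.card_coe_set_eq]
  congr 1
  ext q
  constructor
  · intro hq
    obtain ⟨l', hl'⟩ := q.exists_hasWord_cons (a := 1) le_rfl (by omega)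
    exact ⟨l', (intersectionMatrix_ne_zero_iff (by omega) hl hl').1 hq, hl'.eq_ofWord.symm⟩
  · rintro ⟨l', hl', rfl⟩
    refine (intersectionMatrix_ne_zero_iff (by omega) hl (hasWord_ofWord ?_)).2 hl'
    rw [range'_one_eq_cons (by omega)]
    exact ((SeparablePair.perm hl').trans hp').cons _

end CircularOrdering

theorem matrixDensity_intersectionMatrix {n : ℕ} (hn : 3 ≤ n) :
    matrixDensity (intersectionMatrix n) = Nat.largeSchroder (n - 2) / (n - 1).factorial := by
  have : Finite (CircularOrdering n) := Quotient.finite _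
  have : Nonempty (CircularOrdering n) := ⟨QuotientGroup.mk 1⟩
  have h1 := CircularOrdering.two_mul_card hn
  have h2 := CircularOrdering.two_mul_card_intersectionMatrix_row hn
  -- The division of natural numbers is exact, because `h2` exhibits the Schröder number as twice a
  -- cardinality.
  rw [matrixDensity_eq_div _ (Nat.largeSchroder (n - 2) / 2) (fun p => by have := h2 p; omega)]
  obtain ⟨p⟩ := this
  rw [← h1, ← h2 p, Nat.mul_div_cancel_left _ two_pos]
  push_cast
  rw [mul_div_mul_left _ _ (two_ne_zero' ℝ)]

/-! ### KLT blocks -/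

section KLT

open CircularOrdering

variable {n : ℕ} {H : Finset ℕ}

/-- The complement of `H` in `{2, …, n-2}`. -/
def kltComplement (n : ℕ) (H : Finset ℕ) : Finset ℕ := Finset.Icc 2 (n - 2) \ H

/-- Pairs of an arrangement of `H` and an arrangement of its complement. -/
def kltArrangements (n : ℕ) (H : Finset ℕ) : Set (List ℕ × List ℕ) :=
  {l : List ℕ | l.Perm H.toList} ×ˢ {l : List ℕ | l.Perm (kltComplement n H).toList}

/-- The word of a row of the KLT block, starting from the label `n - 1`. -/
def kltRowWord (n : ℕ) (x : List ℕ × List ℕ) : List ℕ := (n - 1) :: n :: 1 :: (x.1 ++ x.2)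

/-- The word of a column of the KLT block, starting from the label `n - 1`. -/
def kltColWord (n : ℕ) (x : List ℕ × List ℕ) : List ℕ := (n - 1) :: 1 :: (x.1 ++ n :: x.2)

theorem coe_eq_val_iff {l : List ℕ} {s : Finset ℕ} :
    (l : Multiset ℕ) = s.val ↔ l.Perm s.toList := by
  rw [← Finset.coe_toList, Multiset.coe_eq_coe]

theorem ncard_kltArrangements : (kltArrangements n H).ncard =
    H.card.factorial * (kltComplement n H).card.factorial := by
  rw [kltArrangements, Set.ncard_prod, List.ncard_setOf_perm (Finset.nodup_toList _),
    List.ncard_setOf_perm (Finset.nodup_toList _), Finset.length_toList, Finset.length_toList]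

theorem mem_of_mem_kltArrangements {x : List ℕ × List ℕ} (hx : x ∈ kltArrangements n H) (a : ℕ) :
    (a ∈ x.1 ↔ a ∈ H) ∧ (a ∈ x.2 ↔ a ∈ Finset.Icc 2 (n - 2) \ H) :=
  ⟨(hx.1.mem_iff).trans Finset.mem_toList, (hx.2.mem_iff).trans Finset.mem_toList⟩

theorem nodup_of_mem_kltArrangements {x : List ℕ × List ℕ} (hx : x ∈ kltArrangements n H) :
    (x.1 ++ x.2).Nodup := by
  rw [List.nodup_append']
  refine ⟨hx.1.nodup_iff.2 (Finset.nodup_toList _), hx.2.nodup_iff.2 (Finset.nodup_toList _), ?_⟩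
  intro a h1 h2
  rw [(mem_of_mem_kltArrangements hx a).1] at h1
  rw [(mem_of_mem_kltArrangements hx a).2, Finset.mem_sdiff] at h2
  exact h2.2 h1

theorem mem_append_kltArrangements (hH : H ⊆ Finset.Icc 2 (n - 2)) {x : List ℕ × List ℕ}
    (hx : x ∈ kltArrangements n H) (a : ℕ) : a ∈ x.1 ∨ a ∈ x.2 ↔ 2 ≤ a ∧ a ≤ n - 2 := by
  rw [(mem_of_mem_kltArrangements hx a).1, (mem_of_mem_kltArrangements hx a).2, Finset.mem_sdiff,
    ← Finset.mem_Icc]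
  constructor
  · rintro (h | h)
    · exact hH h
    · exact h.1
  · intro h
    by_cases h' : a ∈ H
    · exact .inl h'
    · exact .inr ⟨h, h'⟩

theorem kltRowWord_perm (hn : 4 ≤ n) (hH : H ⊆ Finset.Icc 2 (n - 2)) {x : List ℕ × List ℕ}
    (hx : x ∈ kltArrangements n H) : (kltRowWord n x).Perm (List.range' 1 n) := by
  have hm := mem_append_kltArrangements hH hx
  refine (List.perm_ext_iff_of_nodup ?_ List.nodup_range').2 fun a => ?_
  · simp only [kltRowWord, List.nodup_cons, List.mem_cons, List.mem_append, hm]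
    exact ⟨by omega, by omega, by omega, nodup_of_mem_kltArrangements hx⟩
  · simp only [kltRowWord, List.mem_cons, List.mem_append, hm, List.mem_range'_1]
    omega

theorem kltColWord_perm (hn : 4 ≤ n) (hH : H ⊆ Finset.Icc 2 (n - 2)) {x : List ℕ × List ℕ}
    (hx : x ∈ kltArrangements n H) : (kltColWord n x).Perm (List.range' 1 n) := by
  refine .trans (.cons _ ?_) (kltRowWord_perm hn hH hx)
  exact ((List.perm_middle).cons 1).trans (.swap _ _ _)

theorem kltRows_eq (hn : 4 ≤ n) (hH : H ⊆ Finset.Icc 2 (n - 2)) :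
    kltRows n H = (fun x => ofWord n (kltRowWord n x)) '' kltArrangements n H := by
  have : NeZero n := ⟨by omega⟩
  ext q
  constructor
  · rintro ⟨h, g, hh, hg, hq⟩
    rw [coe_eq_val_iff] at hh hg
    refine ⟨(h, g), ⟨hh, hg⟩, ?_⟩
    have := hq.append_comm
    exact (HasWord.eq_ofWord (l := kltRowWord n (h, g)) (by simpa [kltRowWord] using this)).symm
  · rintro ⟨⟨h, g⟩, hx, rfl⟩
    refine ⟨h, g, coe_eq_val_iff.2 hx.1, coe_eq_val_iff.2 hx.2, ?_⟩
    have := hasWord_ofWord (kltRowWord_perm hn hH hx)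
    dsimp only
    rw [show kltRowWord n (h, g) = [n - 1, n] ++ ([1] ++ h ++ g) by simp [kltRowWord]] at this ⊢
    exact this.append_comm

theorem kltCols_eq (hn : 4 ≤ n) (hH : H ⊆ Finset.Icc 2 (n - 2)) :
    kltCols n H = (fun x => ofWord n (kltColWord n x)) '' kltArrangements n H := by
  have : NeZero n := ⟨by omega⟩
  ext q
  constructor
  · rintro ⟨h, g, hh, hg, hq⟩
    rw [coe_eq_val_iff] at hh hg
    refine ⟨(h, g), ⟨hh, hg⟩, ?_⟩
    have := hq.append_comm
    exact (HasWord.eq_ofWord (l := kltColWord n (h, g)) (by simpa [kltColWord] using this)).symm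
  · rintro ⟨⟨h, g⟩, hx, rfl⟩
    refine ⟨h, g, coe_eq_val_iff.2 hx.1, coe_eq_val_iff.2 hx.2, ?_⟩
    have := hasWord_ofWord (kltColWord_perm hn hH hx)
    dsimp only
    rw [show kltColWord n (h, g) = [n - 1] ++ ([1] ++ h ++ [n] ++ g) by simp [kltColWord]] at this ⊢
    exact this.append_comm

theorem List.mem_of_cons_eq_reverse {α : Type*} {c : α} {x y : List α}
    (h : c :: x = (c :: y).reverse) (hy : y ≠ []) : c ∈ y := by
  rw [List.reverse_cons] at h
  obtain ⟨z, zs, hz⟩ := List.exists_cons_of_ne_nil (List.reverse_ne_nil_iff.2 hy)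
  rw [hz, List.cons_append] at h
  rw [(List.cons.inj h).1, ← List.mem_reverse, hz]
  exact List.mem_cons_self

/-- The fixed neighbours of n-1 rule out the reversal: it would force `n` to occur twice in the
word. So arrangements are counted without a factor 1/2. -/
theorem injOn_kltRowWord (hn : 4 ≤ n) (hH : H ⊆ Finset.Icc 2 (n - 2)) :
    Set.InjOn (fun x => ofWord n (kltRowWord n x)) (kltArrangements n H) := by
  have : NeZero n := ⟨by omega⟩
  intro x hx y hy hxy
  have h1 := hasWord_ofWord (kltRowWord_perm hn hH hx)
  have h2 := hasWord_ofWord (kltRowWord_perm hn hH hy)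
  dsimp only at hxy
  rw [← hxy] at h2
  rcases h1.eq_or_eq_reverse h2 with h | h
  · have := (List.cons.inj (List.cons.inj h).2).2
    have := List.append_inj this (hy.1.length_eq.trans hx.1.length_eq.symm)
    exact Prod.ext this.1.symm this.2.symm
  · have := List.mem_of_cons_eq_reverse h (by simp)
    rw [List.mem_cons, List.mem_append, mem_append_kltArrangements hH hx] at this
    omega

theorem injOn_kltColWord (hn : 4 ≤ n) (hH : H ⊆ Finset.Icc 2 (n - 2)) :
    Set.InjOn (fun x => ofWord n (kltColWord n x)) (kltArrangements n H) := by
  have : NeZero n := ⟨by omega⟩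
  intro x hx y hy hxy
  have h1 := hasWord_ofWord (kltColWord_perm hn hH hx)
  have h2 := hasWord_ofWord (kltColWord_perm hn hH hy)
  dsimp only at hxy
  rw [← hxy] at h2
  rcases h1.eq_or_eq_reverse h2 with h | h
  · have := (List.cons.inj h).2
    have := List.append_inj this (hy.1.length_eq.trans hx.1.length_eq.symm)
    exact Prod.ext this.1.symm (List.cons.inj this.2).2.symm
  · have := List.mem_of_cons_eq_reverse h (by simp)
    rw [List.mem_append, List.mem_cons, or_left_comm, mem_append_kltArrangements hH hx] at this
    omega

/-- Deleting 1, n and one of the two sets leaves the pair on the other set. The positions of 1 and n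
impose no further condition. -/
theorem separablePair_klt_iff (hn : 4 ≤ n) (hH : H ⊆ Finset.Icc 2 (n - 2)) {x y : List ℕ × List ℕ}
    (hx : x ∈ kltArrangements n H) (hy : y ∈ kltArrangements n H) :
    SeparablePair (n :: 1 :: (x.1 ++ x.2)) (1 :: (y.1 ++ n :: y.2)) ↔
      SeparablePair x.1 y.1 ∧ SeparablePair x.2 y.2 := by
  have hm := mem_append_kltArrangements hH hx
  have hd := nodup_of_mem_kltArrangements hx
  have p1 : y.1.Perm x.1 := hy.1.trans hx.1.symm
  have p2 : y.2.Perm x.2 := hy.2.trans hx.2.symm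
  constructor
  · intro h
    have e : ∀ p : ℕ → Bool, p 1 = false → p n = false →
        SeparablePair ((x.1 ++ x.2).filter p) ((y.1 ++ y.2).filter p) := by
      intro p h1 h2
      have := h.filter p
      simpa [List.filter_append, List.filter_cons, h1, h2] using this
    have n1 : ¬ (1 ∈ x.1 ∨ 1 ∈ x.2) := by rw [hm]; omega
    have n2 : ¬ (n ∈ x.1 ∨ n ∈ x.2) := by rw [hm]; omega
    rw [not_or] at n1 n2
    constructor
    · have := e (fun a => decide (a ∈ x.1)) (by simp [n1.1]) (by simp [n2.1])
      rwa [SeparablePair.filter_mem_append_left hd (.refl _) (.refl _),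
        SeparablePair.filter_mem_append_left hd p1 p2] at this
    · have := e (fun a => decide (a ∈ x.2)) (by simp [n1.2]) (by simp [n2.2])
      rwa [SeparablePair.filter_mem_append_right hd (.refl _) (.refl _),
        SeparablePair.filter_mem_append_right hd p1 p2] at this
  · rintro ⟨h1, h2⟩
    -- The letter n is exchanged with the block (1, h), and then g is appended.
    have := ((SeparablePair.single n).minus ((SeparablePair.single 1).plus h1)).plus h2
    simpa using this

/-- The separable columns form a product set of arrangements, on which passing to circular orderings
is injective. -/
theorem kltBlock_row_card (hn : 4 ≤ n) (hH : H ⊆ Finset.Icc 2 (n - 2)) (h1 : 1 ≤ H.card)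
    (h2 : 1 ≤ (kltComplement n H).card) (p : kltRows n H) :
    Nat.card {q : kltCols n H // kltBlock n H p q ≠ 0} =
      Nat.largeSchroder (H.card - 1) * Nat.largeSchroder ((kltComplement n H).card - 1) := by
  obtain ⟨p, hp⟩ := p
  have hp' := hp
  rw [kltRows_eq hn hH] at hp'
  obtain ⟨x, hx, rfl⟩ := hp'
  have hxw := hasWord_ofWord (kltRowWord_perm hn hH hx)
  have hsub : separableWords x.1 ×ˢ separableWords x.2 ⊆ kltArrangements n H := by
    rintro y ⟨ha, hb⟩
    exact ⟨(SeparablePair.perm ha).trans hx.1, (SeparablePair.perm hb).trans hx.2⟩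
  have hset : {q | q ∈ kltCols n H ∧ intersectionMatrix n (ofWord n (kltRowWord n x)) q ≠ 0} =
      (fun y => ofWord n (kltColWord n y)) '' (separableWords x.1 ×ˢ separableWords x.2) := by
    have key : ∀ y ∈ kltArrangements n H, intersectionMatrix n (ofWord n (kltRowWord n x))
        (ofWord n (kltColWord n y)) ≠ 0 ↔ y ∈ separableWords x.1 ×ˢ separableWords x.2 := by
      intro y hy
      exact (intersectionMatrix_ne_zero_iff (by omega) hxw
        (hasWord_ofWord (kltColWord_perm hn hH hy))).trans (separablePair_klt_iff hn hH hx hy)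
    ext q
    rw [kltCols_eq hn hH]
    constructor
    · rintro ⟨⟨y, hy, rfl⟩, hq⟩
      exact ⟨y, (key y hy).1 hq, rfl⟩
    · rintro ⟨y, hy, rfl⟩
      exact ⟨⟨y, hsub hy, rfl⟩, (key y (hsub hy)).2 hy⟩
  have hcard : Nat.card {q : kltCols n H // kltBlock n H ⟨_, hp⟩ q ≠ 0} =
      {q | q ∈ kltCols n H ∧ intersectionMatrix n (ofWord n (kltRowWord n x)) q ≠ 0}.ncard := by
    rw [← Nat.card_coe_set_eq]
    exact Nat.card_congr (Equiv.subtypeSubtypeEquivSubtypeInter (fun q => q ∈ kltCols n H)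
      (fun q => intersectionMatrix n (ofWord n (kltRowWord n x)) q ≠ 0))
  have hl1 : x.1.length = H.card := by rw [hx.1.length_eq, Finset.length_toList]
  have hl2 : x.2.length = (kltComplement n H).card := by rw [hx.2.length_eq, Finset.length_toList]
  have hd := List.nodup_append'.1 (nodup_of_mem_kltArrangements hx)
  rw [hcard, hset, ((injOn_kltColWord hn hH).mono hsub).ncard_image, Set.ncard_prod,
    ncard_separableWords (H.card - 1) _ hd.1 (by omega),
    ncard_separableWords ((kltComplement n H).card - 1) _ hd.2.1 (by omega)]

theorem card_kltRows (hn : 4 ≤ n) (hH : H ⊆ Finset.Icc 2 (n - 2)) :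
    Nat.card (kltRows n H) = H.card.factorial * (kltComplement n H).card.factorial := by
  rw [Nat.card_coe_set_eq, kltRows_eq hn hH, (injOn_kltRowWord hn hH).ncard_image,
    ncard_kltArrangements]

theorem card_kltCols (hn : 4 ≤ n) (hH : H ⊆ Finset.Icc 2 (n - 2)) :
    Nat.card (kltCols n H) = H.card.factorial * (kltComplement n H).card.factorial := by
  rw [Nat.card_coe_set_eq, kltCols_eq hn hH, (injOn_kltColWord hn hH).ncard_image,
    ncard_kltArrangements]

theorem matrixDensity_kltBlock (hn : 4 ≤ n) (hH : H ⊆ Finset.Icc 2 (n - 2)) (h1 : 1 ≤ H.card)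
    (h2 : 1 ≤ (kltComplement n H).card) : matrixDensity (kltBlock n H) =
      (Nat.largeSchroder (H.card - 1) * Nat.largeSchroder ((kltComplement n H).card - 1) : ℝ) /
        (H.card.factorial * (kltComplement n H).card.factorial) := by
  have hR := card_kltRows hn hH
  have hC := card_kltCols hn hH
  have : Finite (kltRows n H) := Nat.finite_of_card_ne_zero (by rw [hR]; positivity)
  have : Finite (kltCols n H) := Nat.finite_of_card_ne_zero (by rw [hC]; positivity)
  have : Nonempty (kltRows n H) := (Nat.card_pos_iff.1 (by rw [hR]; positivity)).1
  rw [matrixDensity_eq_div _ _ (kltBlock_row_card hn hH h1 h2), hC]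
  push_cast
  rfl

theorem Nat.ceil_sub_three_half {n : ℕ} (hn : 3 ≤ n) : ⌈((n : ℚ) - 3) / 2⌉₊ = (n - 2) / 2 := by
  obtain ⟨k, rfl | rfl⟩ : ∃ k, n = 2 * k + 3 ∨ n = 2 * k + 4 :=
    ⟨(n - 3) / 2, by omega⟩
  · have : (((2 * k + 3 : ℕ) : ℚ) - 3) / 2 = k := by push_cast; ring
    rw [this, Nat.ceil_natCast]
    omega
  · rw [show (2 * k + 4 - 2) / 2 = k + 1 by omega, Nat.ceil_eq_iff (by omega)]
    push_cast
    constructor <;> linarith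

theorem Nat.floor_sub_three_half {n : ℕ} (hn : 3 ≤ n) : ⌊((n : ℚ) - 3) / 2⌋₊ = (n - 3) / 2 := by
  obtain ⟨k, rfl | rfl⟩ : ∃ k, n = 2 * k + 3 ∨ n = 2 * k + 4 :=
    ⟨(n - 3) / 2, by omega⟩
  · have : (((2 * k + 3 : ℕ) : ℚ) - 3) / 2 = k := by push_cast; ring
    rw [this, Nat.floor_natCast]
    omega
  · rw [show (2 * k + 4 - 3) / 2 = k by omega, Nat.floor_eq_iff (by push_cast; linarith [(Nat.cast_nonneg k : (0 : ℚ) ≤ k)])]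
    push_cast
    constructor <;> linarith

theorem IsKLTIndex.card_eq (hn : 7 ≤ n) (h : IsKLTIndex n H) :
    H.card = (n - 2) / 2 ∧ (kltComplement n H).card = (n - 3) / 2 := by
  have h1 : H.card = (n - 2) / 2 := by rw [h.2, Nat.ceil_sub_three_half (by omega)]
  refine ⟨h1, ?_⟩
  rw [kltComplement, Finset.card_sdiff_of_subset h.1, h1, Nat.card_Icc]
  omega

/-- The bound on `k` is sharp: at `k = 1` both sequences take the value 1. -/
theorem Nat.two_mul_smallSchroder {k : ℕ} (hk : 2 ≤ k) :
    2 * Nat.smallSchroder k = Nat.largeSchroder (k - 1) := by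
  obtain ⟨j, rfl⟩ : ∃ j, k = j + 1 := ⟨k - 1, by omega⟩
  exact Nat.two_mul_smallSchroder_succ (by omega)

end KLT

/-! ### Assembly of the theorem -/

theorem mainTheorem5 :
    (∀ (n : ℕ), 7 ≤ n → ∀ (m m' d : ℕ),
      m = ⌈((n : ℚ) - 3) / 2⌉₊ + 1 → m' = ⌊((n : ℚ) - 3) / 2⌋₊ + 1 →
      d = ⌈((n : ℚ) - 3) / 2⌉₊.factorial * ⌊((n : ℚ) - 3) / 2⌋₊.factorial →
      ∀ H : Finset ℕ, IsKLTIndex n H →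
        Nat.card (kltRows n H) = d ∧ Nat.card (kltCols n H) = d ∧
        (∀ p : kltRows n H, Nat.card {q : kltCols n H // kltBlock n H p q ≠ 0} =
          4 * Nat.smallSchroder (m - 1) * Nat.smallSchroder (m' - 1)) ∧
        matrixDensity (kltBlock n H) =
          (4 * Nat.smallSchroder (m - 1) * Nat.smallSchroder (m' - 1) : ℝ) /
            ((m - 1).factorial * (m' - 1).factorial) ∧
        matrixDensity (kltBlock n H) =
          matrixDensity (intersectionMatrix m) * matrixDensity (intersectionMatrix m')) ∧
    |(1 + Real.log 2 + Real.log (3 + Real.sqrt 8)) - 3.46| < 0.005 ∧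
    ∃ C : ℝ, ∀ (n : ℕ), 7 ≤ n → ∀ H : Finset ℕ, IsKLTIndex n H →
      0 < matrixDensity (kltBlock n H) ∧
      |Real.log (matrixDensity (kltBlock n H)) -
        (-(n * (Real.log n - (1 + Real.log 2 + Real.log (3 + Real.sqrt 8)))))| ≤
        C * Real.log n := by
  refine ⟨?_, abs_rate_sub_lt, ?_⟩
  · intro n hn m m' d hm hm' hd H hH
    obtain ⟨hk, hl⟩ := hH.card_eq hn
    rw [Nat.ceil_sub_three_half (by omega), ← hk] at hm hd
    rw [Nat.floor_sub_three_half (by omega), ← hl] at hm' hd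
    -- This is where n ≥ 7 enters: both sets have at least two elements, so each large Schröder
    -- number is twice a small one and both smaller matrices have at least three leaves.
    have hk2 : 2 ≤ H.card := by omega
    have hl2 : 2 ≤ (kltComplement n H).card := by omega
    have hs : 4 * Nat.smallSchroder H.card * Nat.smallSchroder (kltComplement n H).card =
        Nat.largeSchroder (H.card - 1) * Nat.largeSchroder ((kltComplement n H).card - 1) := by
      rw [← Nat.two_mul_smallSchroder hk2, ← Nat.two_mul_smallSchroder hl2]
      ring
    have hden := matrixDensity_kltBlock (by omega) hH.1 (by omega) (by omega)
    subst hm hm' hd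
    simp only [Nat.add_sub_cancel]
    refine ⟨card_kltRows (by omega) hH.1, card_kltCols (by omega) hH.1, fun p => ?_, ?_, ?_⟩
    · rw [kltBlock_row_card (by omega) hH.1 (by omega) (by omega), hs]
    · rw [hden]
      congr 1
      exact_mod_cast hs.symm
    · rw [hden, matrixDensity_intersectionMatrix (by omega),
        matrixDensity_intersectionMatrix (by omega), div_mul_div_comm]
      -- The indices (k+1) - 2 and k - 1 agree by computation.
      rfl
  · obtain ⟨C, hC⟩ := exists_abs_log_density_sub_le
    refine ⟨C, fun n hn H hH => ?_⟩
    obtain ⟨hk, hl⟩ := hH.card_eq hn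
    rw [matrixDensity_kltBlock (by omega) hH.1 (by omega) (by omega)]
    refine ⟨?_, hC n _ _ hn (by omega) (by omega) (by omega)⟩
    have h1 := largeSchroder_pos (H.card - 1)
    have h2 := largeSchroder_pos ((kltComplement n H).card - 1)
    positivity
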